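/- Let $m\ge 1$, $n\ge 0$ and let $m\mathcal{TL}_n$ be the $m$-cyclic Temperley--Lieb monoid: its elements are pairs $(a,i)$ of a crossingless perfect matching $a$ of $n$ top and $n$ bottom points of a strip and $i\in\mathbb Z/m\mathbb Z$, with product $(a,i)(b,j)=(ab,\,i+j+\Phi(a,b))$, where $ab$ is obtained by stacking $a$ on top of $b$ and $\Phi(a,b)$ is the number of closed components that arise. Let $0\le k<l\le n$ with $k\equiv l\equiv n \pmod 2$ and $l\ge 3$, and assume that $(n,k,l)$ is neither $(3,1,3)$ nor $(4,0,4)$. Let $\mathcal S=m\mathcal{TL}_n^{k\le l}$ be the truncated monoid, that is, the submonoid of $m\mathcal{TL}_n$ consisting of the identity and all diagrams with at most $l$ through strands, in which, if $k\ge 2$, all diagrams with fewer than $k$ through strands are identified to one zero element (if $k\le 1$ there are no such diagrams, and no zero is added). Let $\mathcal G$ be the group of units of $\mathcal S$, and let $\mathbb K$ be a field with $\operatorname{char}\mathbb K\nmid m$. Then: 1. $\mathcal S$ is well-connected: $\mathcal S\setminus\mathcal G$ is non-empty; every element of $\mathcal S\setminus\mathcal G$ is a product of two elements of $\mathcal S\setminus\mathcal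 G$ (null-connected); $\mathcal S\setminus\mathcal G$ is a single class of the equivalence relation generated by $ba\approx_l a$ for $a,b\in\mathcal S\setminus\mathcal G$ (left-connected), and a single class of the one generated by $ab\approx_r a$ for $a,b\in\mathcal S\setminus\mathcal G$ (right-connected). 2. The only monoid homomorphism $\mathcal S\to(\mathbb K,+)$ is $0$. 3. Let $\mathbb 1_t$ be the one-dimensional representation $s\mapsto 1$ of $\mathcal S$ and $\mathbb 1_b$ the one with $s\mapsto 1$ for $s\in\mathcal G$ and $s\mapsto 0$ otherwise; call $(\mathcal S,\mathbb K)$ $r$-trivial if every representation of $\mathcal S$ over $\mathbb K$ of dimension at most $r$ is isomorphic to a direct sum of copies of $\mathbb 1_b$ and $\mathbb 1_t$, except that, by convention, the trivial monoid and the monoid $\{1,a\}$ with $a^2=a\neq 1$ are only $(-1)$-trivial. Then $\mathcal S$ has a simple representation not isomorphic to $\mathbb 1_b$ or $\mathbb 1_t$, and the representation gap $\operatorname{gap}_{\mathbb K}(\mathcal S)=\max\{r\mid(\mathcal S,\mathbb K)\text{ is }(r-1)\text{-trivial}\}$ exists and equals \[\min\{\dim_{\mathbb K}L\mid L\text{ a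 simple representation of }\mathcal S,\ L\not\cong\mathbb 1_b,\ L\not\cong\mathbb 1_t\}.\] -/

import Mathlib

universe u

/-! ### Diagrams with `n` top and `n` bottom points, stacking, internal components -/

/-- The boundary points of a diagram on `n` strands: `inl i` is the `i`-th top point and
`inr i` is the `i`-th bottom point, both counted from the left. -/
abbrev BPoint (n : ℕ) : Type := Fin n ⊕ Fin n

/-- The points that occur when two diagrams on `n` strands are stacked: the top points, the
middle points (along which the diagrams are glued) and the bottom points. -/
abbrev GPoint (n : ℕ) : Type := Fin n ⊕ (Fin n ⊕ Fin n)

/-- The boundary points of the upper diagram of a stack. -/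
def upperPt {n : ℕ} : BPoint n → GPoint n := Sum.elim Sum.inl (fun i => Sum.inr (Sum.inl i))

/-- The boundary points of the lower diagram of a stack. -/
def lowerPt {n : ℕ} : BPoint n → GPoint n :=
  Sum.elim (fun i => Sum.inr (Sum.inl i)) (fun i => Sum.inr (Sum.inr i))

/-- The boundary points of the stack itself. -/
def outerPt {n : ℕ} : BPoint n → GPoint n := Sum.elim Sum.inl (fun i => Sum.inr (Sum.inr i))

/-- The graph obtained by stacking `a` on top of `b`; the blocks of a set partition are the
sets of points that the diagram connects. -/
def glueGraph {n : ℕ} (a b : Setoid (BPoint n)) : SimpleGraph (GPoint n) :=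
  SimpleGraph.fromRel fun x y =>
    (∃ p q, a p q ∧ upperPt p = x ∧ upperPt q = y) ∨ (∃ p q, b p q ∧ lowerPt p = x ∧ lowerPt q = y)

/-- The skeleton of the stack of `a` on top of `b`. -/
def stack {n : ℕ} (a b : Setoid (BPoint n)) : Setoid (BPoint n) :=
  Setoid.comap outerPt (glueGraph a b).reachableSetoid

/-- The number of internal components that arise when `a` is stacked on top of `b`: the
connected components of the stack that contain no boundary point of the stack. -/
noncomputable def stackLoops {n : ℕ} (a b : Setoid (BPoint n)) : ℕ :=
  Nat.card {c : (glueGraph a b).ConnectedComponent //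
    ∀ p : BPoint n, (glueGraph a b).connectedComponentMk (outerPt p) ≠ c}

/-- The identity diagram: the `i`-th top point is connected to the `i`-th bottom point. -/
def idDiagram (n : ℕ) : Setoid (BPoint n) := Setoid.ker (Sum.elim id id : BPoint n → Fin n)

section DiagramFacts

variable {n : ℕ}

theorem glue_upper {a b : Setoid (BPoint n)} {p q : BPoint n} (h : a p q) :
    (glueGraph a b).Reachable (upperPt p) (upperPt q) := by
  by_cases e : upperPt p = upperPt q
  · rw [e]
  · exact SimpleGraph.Adj.reachable
      ((SimpleGraph.fromRel_adj _ _ _).2 ⟨e, Or.inl (Or.inl ⟨p, q, h, rfl, rfl⟩)⟩)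

theorem glue_lower {a b : Setoid (BPoint n)} {p q : BPoint n} (h : b p q) :
    (glueGraph a b).Reachable (lowerPt p) (lowerPt q) := by
  by_cases e : lowerPt p = lowerPt q
  · rw [e]
  · exact SimpleGraph.Adj.reachable
      ((SimpleGraph.fromRel_adj _ _ _).2 ⟨e, Or.inl (Or.inr ⟨p, q, h, rfl, rfl⟩)⟩)

/-- A reflexive, symmetric and transitive relation that holds along the strands of both diagrams
holds along the components of the stack. -/
theorem glue_induction {a b : Setoid (BPoint n)} {S : GPoint n → GPoint n → Prop}
    (hS : Equivalence S) (ha : ∀ p q, a p q → S (upperPt p) (upperPt q))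
    (hb : ∀ p q, b p q → S (lowerPt p) (lowerPt q)) {x y : GPoint n}
    (h : (glueGraph a b).Reachable x y) : S x y := by
  obtain ⟨w⟩ := h
  induction w with
  | nil => exact hS.refl _
  | cons hadj _ ih =>
    refine hS.trans ?_ ih
    obtain ⟨-, h | h⟩ := (SimpleGraph.fromRel_adj _ _ _).1 hadj
    · rcases h with ⟨p, q, h, rfl, rfl⟩ | ⟨p, q, h, rfl, rfl⟩
      · exact ha _ _ h
      · exact hb _ _ h
    · rcases h with ⟨p, q, h, rfl, rfl⟩ | ⟨p, q, h, rfl, rfl⟩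
      · exact hS.symm (ha _ _ h)
      · exact hS.symm (hb _ _ h)

/-- A two-colouring `f` of the top points and `g` of the bottom points is constant on the blocks
of `a`. -/
def Colours (a : Setoid (BPoint n)) (f g : Fin n → Bool) : Prop :=
  ∀ p q, a p q → (Sum.elim f g p : Bool) = Sum.elim f g q

open Classical in
/-- The matrix of admissible two-colourings of a diagram; only used to prove associativity. -/
noncomputable def colourMatrix (a : Setoid (BPoint n)) :
    Matrix (Fin n → Bool) (Fin n → Bool) ℕ :=
  Matrix.of fun f g => if Colours a f g then 1 else 0

theorem colours_glue {a b : Setoid (BPoint n)} {f h g : Fin n → Bool}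
    (ha : Colours a f h) (hb : Colours b h g) {x y : GPoint n}
    (hxy : (glueGraph a b).Reachable x y) :
    (Sum.elim f (Sum.elim h g) x : Bool) = Sum.elim f (Sum.elim h g) y := by
  refine glue_induction (S := fun x y => (Sum.elim f (Sum.elim h g) x : Bool) =
    Sum.elim f (Sum.elim h g) y) ⟨fun _ => rfl, fun h => h.symm, fun h k => h.trans k⟩ ?_ ?_ hxy
  · intro p q hpq
    have := ha p q hpq
    rcases p with p | p <;> rcases q with q | q <;> simpa [upperPt] using this
  · intro p q hpq
    have := hb p q hpq
    rcases p with p | p <;> rcases q with q | q <;> simpa [lowerPt] using this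

theorem elim_outer (f h g : Fin n → Bool) (p : BPoint n) :
    (Sum.elim f (Sum.elim h g) (outerPt p) : Bool) = Sum.elim f g p := by
  rcases p with p | p <;> rfl

theorem colour_count (a b : Setoid (BPoint n)) (f g : Fin n → Bool) (hc : Colours (stack a b) f g) :
    Nat.card {h : Fin n → Bool // Colours a f h ∧ Colours b h g} = 2 ^ stackLoops a b := by
  classical
  set G := glueGraph a b
  let F : {h : Fin n → Bool // Colours a f h ∧ Colours b h g} →
      ({c : G.ConnectedComponent // ∀ p : BPoint n, G.connectedComponentMk (outerPt p) ≠ c} →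
        Bool) := fun h c => Sum.elim f (Sum.elim h.1 g) (Quot.out c.1)
  have hout : ∀ x : GPoint n, G.Reachable (Quot.out (G.connectedComponentMk x)) x := fun x =>
    SimpleGraph.ConnectedComponent.exact (Quot.out_eq (G.connectedComponentMk x))
  have hF : Function.Bijective F := by
    constructor
    · rintro ⟨h, h1, h2⟩ ⟨k, k1, k2⟩ hhk
      apply Subtype.ext
      funext i
      by_cases hi : ∃ p, G.connectedComponentMk (outerPt p) =
          G.connectedComponentMk (Sum.inr (Sum.inl i))
      · obtain ⟨p, hp⟩ := hi
        have hp := SimpleGraph.ConnectedComponent.exact hp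
        have e1 := colours_glue h1 h2 hp
        have e2 := colours_glue k1 k2 hp
        rw [elim_outer] at e1 e2
        exact e1.symm.trans e2
      · push Not at hi
        have e := congrFun hhk ⟨_, hi⟩
        have e1 := colours_glue h1 h2 (hout (Sum.inr (Sum.inl i)))
        have e2 := colours_glue k1 k2 (hout (Sum.inr (Sum.inl i)))
        exact e1.symm.trans (e.trans e2)
    · intro ψ
      let κ : G.ConnectedComponent → Bool := fun c =>
        if hc : ∃ p, G.connectedComponentMk (outerPt p) = c then Sum.elim f g hc.choose
        else ψ ⟨c, fun p hp => hc ⟨p, hp⟩⟩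
      have hκ : ∀ p, κ (G.connectedComponentMk (outerPt p)) = Sum.elim f g p := by
        intro p
        have hex : ∃ q, G.connectedComponentMk (outerPt q) = G.connectedComponentMk (outerPt p) :=
          ⟨p, rfl⟩
        simp only [κ, dif_pos hex]
        exact hc _ _ (SimpleGraph.ConnectedComponent.exact hex.choose_spec)
      let h : Fin n → Bool := fun i => κ (G.connectedComponentMk (Sum.inr (Sum.inl i)))
      have key : ∀ x, (Sum.elim f (Sum.elim h g) x : Bool) = κ (G.connectedComponentMk x) := by
        rintro (i | i | i)
        · exact (hκ (Sum.inl i)).symm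
        · rfl
        · exact (hκ (Sum.inr i)).symm
      have hu : ∀ p, (Sum.elim f h p : Bool) = κ (G.connectedComponentMk (upperPt p)) := by
        intro p
        rw [← key]
        rcases p with p | p <;> rfl
      have hl : ∀ p, (Sum.elim h g p : Bool) = κ (G.connectedComponentMk (lowerPt p)) := by
        intro p
        rw [← key]
        rcases p with p | p <;> rfl
      refine ⟨⟨h, ?_, ?_⟩, ?_⟩
      · intro p q hpq
        rw [hu, hu, SimpleGraph.ConnectedComponent.sound (glue_upper hpq)]
      · intro p q hpq
        rw [hl, hl, SimpleGraph.ConnectedComponent.sound (glue_lower hpq)]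
      · funext c
        change (Sum.elim f (Sum.elim h g) (Quot.out c.1) : Bool) = ψ c
        rw [key]
        have hq : G.connectedComponentMk (Quot.out c.1) = c.1 := Quot.out_eq c.1
        rw [hq]
        have hne : ¬ ∃ p, G.connectedComponentMk (outerPt p) = c.1 := fun ⟨p, hp⟩ => c.2 p hp
        simp only [κ, dif_neg hne]
  rw [Nat.card_congr (Equiv.ofBijective F hF), Nat.card_fun]
  simp [stackLoops, G]

theorem colourMatrix_mul (a b : Setoid (BPoint n)) :
    colourMatrix a * colourMatrix b = 2 ^ stackLoops a b • colourMatrix (stack a b) := by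
  classical
  ext f g
  have h1 : (colourMatrix a * colourMatrix b) f g =
      Nat.card {h : Fin n → Bool // Colours a f h ∧ Colours b h g} := by
    rw [Matrix.mul_apply, Nat.card_eq_fintype_card, Fintype.card_subtype,
      Finset.card_eq_sum_ones, Finset.sum_filter]
    refine Finset.sum_congr rfl fun h _ => ?_
    by_cases h1 : Colours a f h <;> by_cases h2 : Colours b h g <;> simp [colourMatrix, h1, h2]
  rw [h1]
  by_cases hc : Colours (stack a b) f g
  · rw [colour_count a b f g hc]
    simp [colourMatrix, hc]
  · have : IsEmpty {h : Fin n → Bool // Colours a f h ∧ Colours b h g} := by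
      refine ⟨fun ⟨h, h1, h2⟩ => hc fun p q hpq => ?_⟩
      have := colours_glue h1 h2 hpq
      rwa [elim_outer, elim_outer] at this
    simp [colourMatrix, hc]

theorem colourMatrix_const (a : Setoid (BPoint n)) :
    colourMatrix a (fun _ => true) (fun _ => true) = 1 := by
  have : Colours a (fun _ => true) (fun _ => true) := by
    rintro (p | p) (q | q) _ <;> rfl
  simp [colourMatrix, this]

theorem colourMatrix_inj {a b : Setoid (BPoint n)} (h : colourMatrix a = colourMatrix b) :
    a = b := by
  classical
  have key : ∀ f g, Colours a f g ↔ Colours b f g := by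
    intro f g
    have := congrFun (congrFun h f) g
    simp only [colourMatrix, Matrix.of_apply] at this
    by_cases h1 : Colours a f g <;> by_cases h2 : Colours b f g <;> simp [h1, h2] at this ⊢
  have main : ∀ c d : Setoid (BPoint n), (∀ f g, Colours c f g → Colours d f g) →
      ∀ p q, d p q → c p q := by
    intro c d hcd p q hpq
    have e : ∀ r : BPoint n, (Sum.elim (fun i => decide (c p (Sum.inl i)))
        (fun i => decide (c p (Sum.inr i))) r : Bool) = decide (c p r) := by
      rintro (r | r) <;> rfl
    have hc : Colours c (fun i => decide (c p (Sum.inl i))) (fun i => decide (c p (Sum.inr i))) := by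
      intro r s hrs
      rw [e, e, decide_eq_decide]
      exact ⟨fun h => c.trans' h hrs, fun h => c.trans' h (c.symm' hrs)⟩
    have := hcd _ _ hc p q hpq
    rw [e, e, decide_eq_decide] at this
    exact this.1 (c.refl' p)
  ext p q
  exact ⟨main b a (fun f g => (key f g).2) p q, main a b (fun f g => (key f g).1) p q⟩

theorem colourMatrix_id : colourMatrix (idDiagram n) = 1 := by
  classical
  ext f g
  have : Colours (idDiagram n) f g ↔ f = g := by
    constructor
    · intro h
      funext i
      exact h (Sum.inl i) (Sum.inr i) rfl
    · rintro rfl p q hpq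
      have hpq : (Sum.elim id id p : Fin n) = Sum.elim id id q := hpq
      rcases p with p | p <;> rcases q with q | q <;> simp_all
  simp [colourMatrix, this, Matrix.one_apply]

theorem colourMatrix_smul_inj {a b : Setoid (BPoint n)} {i j : ℕ}
    (h : 2 ^ i • colourMatrix a = 2 ^ j • colourMatrix b) : i = j ∧ a = b := by
  have h1 := congrFun (congrFun h (fun _ => true)) (fun _ => true)
  simp only [Matrix.smul_apply, colourMatrix_const, smul_eq_mul, mul_one] at h1
  have hij : i = j := Nat.pow_right_injective le_rfl h1
  subst hij
  refine ⟨rfl, colourMatrix_inj ?_⟩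
  ext f g
  have h2 := congrFun (congrFun h f) g
  simp only [Matrix.smul_apply, smul_eq_mul] at h2
  exact Nat.eq_of_mul_eq_mul_left (by positivity) h2

theorem stack_assoc (a b c : Setoid (BPoint n)) :
    stackLoops a b + stackLoops (stack a b) c = stackLoops b c + stackLoops a (stack b c) ∧
      stack (stack a b) c = stack a (stack b c) := by
  apply colourMatrix_smul_inj
  have h := Matrix.mul_assoc (colourMatrix a) (colourMatrix b) (colourMatrix c)
  rw [colourMatrix_mul, colourMatrix_mul, Matrix.smul_mul, Matrix.mul_smul, colourMatrix_mul,
    colourMatrix_mul, smul_smul, smul_smul, ← pow_add, ← pow_add] at h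
  exact h

theorem id_stack (a : Setoid (BPoint n)) :
    stackLoops (idDiagram n) a = 0 ∧ stack (idDiagram n) a = a := by
  apply colourMatrix_smul_inj
  rw [← colourMatrix_mul, colourMatrix_id, Matrix.one_mul, pow_zero, one_smul]

theorem stack_id (a : Setoid (BPoint n)) :
    stackLoops a (idDiagram n) = 0 ∧ stack a (idDiagram n) = a := by
  apply colourMatrix_smul_inj
  rw [← colourMatrix_mul, colourMatrix_id, Matrix.mul_one, pow_zero, one_smul]

end DiagramFacts

/-- A diagram on `n` strands together with its number of internal components, counted
modulo `m`. -/
@[ext]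
structure LoopDiagram (m n : ℕ) : Type where
  /-- The skeleton: which boundary points are connected. -/
  skel : Setoid (BPoint n)
  /-- The number of internal components modulo `m`. -/
  loops : ZMod m

/-- Multiplication is vertical stacking, `(a, i) (b, j) = (ab, i + j + Φ(a, b))`. -/
noncomputable instance (m n : ℕ) : Monoid (LoopDiagram m n) where
  mul x y := ⟨stack x.skel y.skel, x.loops + y.loops + (stackLoops x.skel y.skel : ZMod m)⟩
  one := ⟨idDiagram n, 0⟩
  mul_assoc x y z := by
    have h := stack_assoc x.skel y.skel z.skel
    refine LoopDiagram.ext h.2 ?_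
    have h1 := congrArg (Nat.cast : ℕ → ZMod m) h.1
    push_cast at h1
    change x.loops + y.loops + (stackLoops x.skel y.skel : ZMod m) + z.loops +
        (stackLoops (stack x.skel y.skel) z.skel : ZMod m) =
      x.loops + (y.loops + z.loops + (stackLoops y.skel z.skel : ZMod m)) +
        (stackLoops x.skel (stack y.skel z.skel) : ZMod m)
    linear_combination h1
  one_mul x := by
    refine LoopDiagram.ext (id_stack x.skel).2 ?_
    change 0 + x.loops + (stackLoops (idDiagram n) x.skel : ZMod m) = x.loops
    rw [(id_stack x.skel).1]
    simp
  mul_one x := by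
    refine LoopDiagram.ext (stack_id x.skel).2 ?_
    change x.loops + 0 + (stackLoops x.skel (idDiagram n) : ZMod m) = x.loops
    rw [(stack_id x.skel).1]
    simp

/-! ### Crossingless matchings -/

/-- Every boundary point is connected to exactly one other boundary point. -/
def IsMatching {n : ℕ} (a : Setoid (BPoint n)) : Prop := ∀ p, ∃! q, q ≠ p ∧ a p q

/-- The position of a boundary point when one walks around the boundary of the strip: the top
points from left to right, then the bottom points from right to left. -/
def bpos {n : ℕ} : BPoint n → ℕ := Sum.elim (fun i => (i : ℕ)) (fun i => 2 * n - 1 - (i : ℕ))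

/-- No two strands cross: the end points of two strands never alternate along the boundary. -/
def IsCrossingless {n : ℕ} (a : Setoid (BPoint n)) : Prop :=
  ∀ p q r s, bpos p < bpos q → bpos q < bpos r → bpos r < bpos s → ¬ (a p r ∧ a q s)

section MatchingFacts

variable {n : ℕ}

theorem bpos_inj {p q : BPoint n} (h : bpos p = bpos q) : p = q := by
  rcases p with p | p <;> rcases q with q | q <;> simp only [bpos, Sum.elim_inl, Sum.elim_inr] at h <;>
    first
      | (congr 1; ext; omega)
      | (exfalso; omega)

theorem IsMatching.exists_partner {a : Setoid (BPoint n)} (ha : IsMatching a) :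
    ∃ σ : BPoint n → BPoint n, (∀ p, σ p ≠ p) ∧ (∀ p, a p (σ p)) ∧ (∀ p, σ (σ p) = p) ∧
      ∀ p q, a p q → q = p ∨ q = σ p := by
  choose σ hσ hu using ha
  refine ⟨σ, fun p => (hσ p).1, fun p => (hσ p).2, fun p => ?_, fun p q h => ?_⟩
  · exact (hu (σ p) p ⟨(hσ p).1.symm, a.symm' (hσ p).2⟩).symm
  · by_cases e : q = p
    · exact Or.inl e
    · exact Or.inr (hu p q ⟨e, h⟩)

theorem IsMatching.sum_eq_zero {a : Setoid (BPoint n)} (ha : IsMatching a) (f : BPoint n → ZMod 2)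
    (hf : ∀ p q, a p q → f p = f q) : ∑ p, f p = 0 := by
  obtain ⟨σ, h1, h2, h3, -⟩ := ha.exists_partner
  refine Finset.sum_ninvolution σ (fun p => ?_) (fun p _ => h1 p) (fun p => Finset.mem_univ _) h3
  rw [← hf p (σ p) (h2 p)]
  exact CharTwo.add_self_eq_zero _

/-- The sum of `χ` over the boundary points before `x`. -/
def posSum (χ : BPoint n → ZMod 2) (x : BPoint n) : ZMod 2 :=
  ∑ z, if bpos z < bpos x then χ z else 0

theorem posSum_inl (χ : BPoint n → ZMod 2) (i : Fin n) :
    posSum χ (Sum.inl i) = ∑ j, if j < i then χ (Sum.inl j) else 0 := by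
  rw [posSum, Fintype.sum_sum_type]
  have : ∀ j : Fin n, ¬ (2 * n - 1 - (j : ℕ) < (i : ℕ)) := fun j => by omega
  simp [bpos, this]

theorem posSum_inr (χ : BPoint n → ZMod 2) (i : Fin n) :
    posSum χ (Sum.inr i) = (∑ j, χ (Sum.inl j)) + ∑ j, if i < j then χ (Sum.inr j) else 0 := by
  rw [posSum, Fintype.sum_sum_type]
  have h1 : ∀ j : Fin n, (j : ℕ) < 2 * n - 1 - (i : ℕ) := fun j => by omega
  have h2 : ∀ j : Fin n, (2 * n - 1 - (j : ℕ) < 2 * n - 1 - (i : ℕ)) ↔ i < j := fun j => by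
    rw [Fin.lt_def]; omega
  simp [bpos, h1, h2]

theorem posSum_pair {χ : BPoint n → ZMod 2} {p r : BPoint n} (hne : p ≠ r)
    (hval : ∀ z, χ z = (if z = p then 1 else 0) + (if z = r then 1 else 0)) (x : BPoint n) :
    posSum χ x = (if bpos p < bpos x then 1 else 0) + (if bpos r < bpos x then 1 else 0) := by
  have : ∀ z, (if bpos z < bpos x then χ z else 0) =
      (if z = p then (if bpos p < bpos x then (1 : ZMod 2) else 0) else 0) +
        (if z = r then (if bpos r < bpos x then (1 : ZMod 2) else 0) else 0) := by
    intro z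
    rw [hval]
    by_cases hzp : z = p
    · rw [hzp, if_pos rfl, if_neg hne, if_pos rfl, if_neg hne, add_zero, add_zero]
    · by_cases hzr : z = r
      · rw [hzr, if_pos rfl, if_neg hne.symm, if_pos rfl, if_neg hne.symm, zero_add, zero_add]
      · rw [if_neg hzp, if_neg hzr, if_neg hzp, if_neg hzr, add_zero, ite_self]
  rw [posSum, Finset.sum_congr rfl fun z _ => this z, Finset.sum_add_distrib]
  simp

theorem posSum_eq {a : Setoid (BPoint n)} (ha : IsMatching a) (hc : IsCrossingless a)
    (χ : BPoint n → ZMod 2) (hχ : ∀ p q, a p q → χ p = χ q) {x y : BPoint n} (hxy : a x y)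
    (hx : χ x = 0) : posSum χ x = posSum χ y := by
  wlog hlt : bpos x < bpos y generalizing x y
  · rcases (not_lt.1 hlt).lt_or_eq with h | h
    · exact (this (a.symm' hxy) ((hχ x y hxy).symm.trans hx) h).symm
    · rw [bpos_inj h]
  obtain ⟨σ, h1, h2, h3, h4⟩ := ha.exists_partner
  have hinv : ∀ z w, a z w → bpos x < bpos z → bpos z < bpos y → bpos x < bpos w ∧ bpos w < bpos y := by
    intro z w hzw hz1 hz2
    have hzx : ¬ a x z := by
      intro h
      rcases h4 x z h with e | e
      · rw [e] at hz1; exact lt_irrefl _ hz1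
      · rcases h4 x y hxy with e' | e'
        · rw [e'] at hlt; exact lt_irrefl _ hlt
        · rw [e, ← e'] at hz2; exact lt_irrefl _ hz2
    constructor
    · by_contra hcon
      rcases (not_lt.1 hcon).lt_or_eq with h | h
      · exact hc w x z y h hz1 hz2 ⟨a.symm' hzw, hxy⟩
      · rw [bpos_inj h] at hzw; exact hzx (a.symm' hzw)
    · by_contra hcon
      rcases (not_lt.1 hcon).lt_or_eq with h | h
      · exact hc x z y w hz1 hz2 h ⟨hxy, hzw⟩
      · rw [← bpos_inj h] at hzw; exact hzx (a.trans' hxy (a.symm' hzw))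
  have hzero := ha.sum_eq_zero (fun z => if bpos x < bpos z ∧ bpos z < bpos y then χ z else 0) (by
    intro p q hpq
    have : (bpos x < bpos p ∧ bpos p < bpos y) ↔ (bpos x < bpos q ∧ bpos q < bpos y) :=
      ⟨fun h => hinv p q hpq h.1 h.2, fun h => hinv q p (a.symm' hpq) h.1 h.2⟩
    simp only [this, hχ p q hpq])
  have hsum : posSum χ y = posSum χ x +
      ∑ z, (if bpos x < bpos z ∧ bpos z < bpos y then χ z else 0) := by
    rw [posSum, posSum, ← Finset.sum_add_distrib]
    refine Finset.sum_congr rfl fun z _ => ?_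
    rcases lt_trichotomy (bpos z) (bpos x) with h | h | h
    · rw [if_pos (h.trans hlt), if_pos h, if_neg (fun h' => absurd h'.1 (not_lt.2 h.le)), add_zero]
    · rw [bpos_inj h]; simp [hx]
    · simp [h, not_lt.2 h.le]
  rw [hsum, hzero, add_zero]

open Classical in
theorem stack_class_card_le {a b : Setoid (BPoint n)} (ha : IsMatching a) (hb : IsMatching b)
    (p : BPoint n) :
    (Finset.univ.filter fun q => (glueGraph a b).Reachable (outerPt p) (outerPt q)).card ≤ 2 := by
  obtain ⟨σ, -, -, -, hσ⟩ := ha.exists_partner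
  obtain ⟨τ, -, -, -, hτ⟩ := hb.exists_partner
  obtain ⟨G, hG⟩ : ∃ G, G = glueGraph a b := ⟨_, rfl⟩
  rw [← hG]
  let C := G.connectedComponentMk (outerPt p)
  let N : GPoint n → Finset (GPoint n) := Sum.elim (fun i => {upperPt (σ (Sum.inl i))})
    (Sum.elim (fun i => {upperPt (σ (Sum.inr i)), lowerPt (τ (Sum.inl i))})
      (fun i => {lowerPt (τ (Sum.inr i))}))
  let w : GPoint n → ℕ := Sum.elim (fun _ => 1) (Sum.elim (fun _ => 2) (fun _ => 1))
  have hNw : ∀ x, (N x).card ≤ w x := by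
    rintro (i | i | i)
    · simp [N, w]
    · exact Finset.card_le_two
    · simp [N, w]
  have hup : ∀ q r, a q r → upperPt q ≠ upperPt r → upperPt r ∈ N (upperPt q) := by
    intro q r hqr hne
    rcases hσ q r hqr with rfl | rfl
    · exact absurd rfl hne
    · rcases q with q | q <;> simp [N, upperPt]
  have hlo : ∀ q r, b q r → lowerPt q ≠ lowerPt r → lowerPt r ∈ N (lowerPt q) := by
    intro q r hqr hne
    rcases hτ q r hqr with rfl | rfl
    · exact absurd rfl hne
    · rcases q with q | q <;> simp [N, lowerPt]
  have hadj : ∀ x y, G.Adj x y → y ∈ N x := by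
    intro x y hxy
    rw [hG] at hxy
    obtain ⟨hne, h | h⟩ := (SimpleGraph.fromRel_adj _ _ _).1 hxy
    · rcases h with ⟨q, r, h, rfl, rfl⟩ | ⟨q, r, h, rfl, rfl⟩
      · exact hup _ _ h hne
      · exact hlo _ _ h hne
    · rcases h with ⟨q, r, h, rfl, rfl⟩ | ⟨q, r, h, rfl, rfl⟩
      · exact hup _ _ (a.symm' h) hne
      · exact hlo _ _ (b.symm' h) hne
  have hdeg : ∀ v : C, C.toSimpleGraph.degree v ≤ w v.1 := by
    intro v
    refine le_trans ?_ (hNw v.1)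
    rw [← SimpleGraph.card_neighborFinset_eq_degree]
    refine Finset.card_le_card_of_injOn Subtype.val ?_ Subtype.val_injective.injOn
    intro u hu
    have hu : C.toSimpleGraph.Adj v u := by simpa using hu
    exact hadj v.1 u.1 hu
  have hvert := C.connected_toSimpleGraph.card_vert_le_card_edgeSet_add_one
  rw [Nat.card_eq_fintype_card, Nat.card_eq_fintype_card, ← SimpleGraph.edgeFinset_card] at hvert
  have hsum := C.toSimpleGraph.sum_degrees_eq_twice_card_edges
  have hle : ∑ v : C, C.toSimpleGraph.degree v ≤ ∑ v : C, w v.1 :=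
    Finset.sum_le_sum fun v _ => hdeg v
  have hmem : ∀ x, x ∈ C ↔ G.Reachable (outerPt p) x := fun x => by
    exact ⟨fun h => (SimpleGraph.ConnectedComponent.exact h).symm,
      fun h => SimpleGraph.ConnectedComponent.sound h.symm⟩
  have hconv : ∀ u : GPoint n → ℕ, ∑ v : C, u v.1 =
      ∑ x, if G.Reachable (outerPt p) x then u x else 0 := by
    intro u
    rw [← Finset.sum_filter]
    exact (Finset.sum_subtype (p := fun x => x ∈ C) _ (fun x => by simp [hmem]) u).symm
  have hcard : Fintype.card C = ∑ x, if G.Reachable (outerPt p) x then 1 else 0 := by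
    rw [← hconv fun _ => 1]; simp
  rw [hconv] at hle
  rw [Finset.card_filter, Fintype.sum_sum_type]
  simp only [Fintype.sum_sum_type, w, Sum.elim_inl, Sum.elim_inr] at hle hcard
  have h2 : (∑ x : Fin n, if G.Reachable (outerPt p) (Sum.inr (Sum.inl x)) then 2 else 0) =
      2 * ∑ x : Fin n, if G.Reachable (outerPt p) (Sum.inr (Sum.inl x)) then 1 else 0 := by
    rw [Finset.mul_sum]
    exact Finset.sum_congr rfl fun x _ => by split_ifs <;> rfl
  have e1 : ∀ i : Fin n, (outerPt (Sum.inl i) : GPoint n) = Sum.inl i := fun _ => rfl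
  have e2 : ∀ i : Fin n, (outerPt (Sum.inr i) : GPoint n) = Sum.inr (Sum.inr i) := fun _ => rfl
  simp only [e1, e2]
  omega

theorem IsMatching.stack {a b : Setoid (BPoint n)} (ha : IsMatching a) (hb : IsMatching b) :
    IsMatching (stack a b) := by
  classical
  intro p
  set G := glueGraph a b with hG
  let χ : GPoint n → ZMod 2 := fun x => if G.Reachable (outerPt p) x then 1 else 0
  have hχ : ∀ x y, G.Reachable x y → χ x = χ y := by
    intro x y h
    have : G.Reachable (outerPt p) x ↔ G.Reachable (outerPt p) y :=
      ⟨fun k => k.trans h, fun k => k.trans h.symm⟩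
    simp only [χ, this]
  have h1 := ha.sum_eq_zero (fun q => χ (upperPt q)) fun q r h => hχ _ _ (glue_upper h)
  have h2 := hb.sum_eq_zero (fun q => χ (lowerPt q)) fun q r h => hχ _ _ (glue_lower h)
  have h3 : ∑ q : BPoint n, χ (outerPt q) = 0 := by
    rw [Fintype.sum_sum_type] at h1 h2 ⊢
    change ∑ i, χ (Sum.inl i) + ∑ i, χ (Sum.inr (Sum.inl i)) = 0 at h1
    change ∑ i, χ (Sum.inr (Sum.inl i)) + ∑ i, χ (Sum.inr (Sum.inr i)) = 0 at h2
    change ∑ i, χ (Sum.inl i) + ∑ i, χ (Sum.inr (Sum.inr i)) = 0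
    have h4 := CharTwo.add_self_eq_zero (∑ i, χ (Sum.inr (Sum.inl i)))
    linear_combination h1 + h2 - h4
  set s := Finset.univ.filter fun q : BPoint n => G.Reachable (outerPt p) (outerPt q) with hs
  have hle : s.card ≤ 2 := stack_class_card_le ha hb p
  have heven : Even s.card := by
    rw [← ZMod.natCast_eq_zero_iff_even, hs, Finset.card_filter]
    push_cast
    exact h3
  have hp : p ∈ s := by simp [hs]
  have hpos : 0 < s.card := Finset.card_pos.2 ⟨p, hp⟩
  have htwo : s.card = 2 := by
    obtain ⟨k, hk⟩ := heven
    omega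
  have herase : (s.erase p).card = 1 := by rw [Finset.card_erase_of_mem hp, htwo]
  obtain ⟨q, hq⟩ := Finset.card_eq_one.1 herase
  have hiff : ∀ r, (r ≠ p ∧ _root_.stack a b p r) ↔ r = q := by
    intro r
    rw [← Finset.mem_singleton, ← hq, Finset.mem_erase, hs, Finset.mem_filter]
    exact ⟨fun h => ⟨h.1, Finset.mem_univ _, h.2⟩, fun h => ⟨h.1, h.2.2⟩⟩
  exact ⟨q, (hiff q).2 rfl, fun r hr => (hiff r).1 hr⟩

theorem IsCrossingless.stack {a b : Setoid (BPoint n)} (ha : IsMatching a) (hb : IsMatching b)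
    (hca : IsCrossingless a) (hcb : IsCrossingless b) : IsCrossingless (stack a b) := by
  classical
  rintro p q r s hpq hqr hrs ⟨hpr, hqs⟩
  have hab := ha.stack hb
  set G := glueGraph a b with hG
  let χ : GPoint n → ZMod 2 := fun x => if G.Reachable (outerPt p) x then 1 else 0
  have hχ : ∀ x y, G.Reachable x y → χ x = χ y := by
    intro x y h
    have : G.Reachable (outerPt p) x ↔ G.Reachable (outerPt p) y :=
      ⟨fun k => k.trans h, fun k => k.trans h.symm⟩
    simp only [χ, this]
  let g : GPoint n → ZMod 2 := Sum.elim (fun i => ∑ j, if j < i then χ (Sum.inl j) else 0)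
    (Sum.elim
      (fun i => (∑ j, χ (Sum.inl j)) + ∑ j, if i < j then χ (Sum.inr (Sum.inl j)) else 0)
      (fun i => (∑ j, χ (Sum.inl j)) + ∑ j, if i < j then χ (Sum.inr (Sum.inr j)) else 0))
  have hgu : ∀ x, g (upperPt x) = posSum (fun z => χ (upperPt z)) x := by
    rintro (i | i)
    · rw [posSum_inl]; rfl
    · rw [posSum_inr]; rfl
  have hgo : ∀ x, g (outerPt x) = posSum (fun z => χ (outerPt z)) x := by
    rintro (i | i)
    · rw [posSum_inl]; rfl
    · rw [posSum_inr]; rfl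
  have hgl : ∀ x, χ (lowerPt x) = 0 → g (lowerPt x) = posSum (fun z => χ (lowerPt z)) x +
      (∑ j, χ (Sum.inl j) + ∑ j, χ (Sum.inr (Sum.inl j))) := by
    rintro (i | i) hi
    · rw [posSum_inl]
      change χ (Sum.inr (Sum.inl i)) = 0 at hi
      change (∑ j, χ (Sum.inl j)) + ∑ j, (if i < j then χ (Sum.inr (Sum.inl j)) else 0) =
        (∑ j, if j < i then χ (Sum.inr (Sum.inl j)) else 0) +
          (∑ j, χ (Sum.inl j) + ∑ j, χ (Sum.inr (Sum.inl j)))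
      have hsplit : ∑ j, χ (Sum.inr (Sum.inl j)) =
          (∑ j, if j < i then χ (Sum.inr (Sum.inl j)) else 0) +
            ∑ j, (if i < j then χ (Sum.inr (Sum.inl j)) else 0) := by
        rw [← Finset.sum_add_distrib]
        refine Finset.sum_congr rfl fun j _ => ?_
        rcases lt_trichotomy j i with h | h | h
        · simp [h, h.le]
        · subst h; simp [hi]
        · simp [h, h.le]
      have h4 := CharTwo.add_self_eq_zero (∑ j, if j < i then χ (Sum.inr (Sum.inl j)) else 0)
      linear_combination - h4 - hsplit
    · rw [posSum_inr]
      change (∑ j, χ (Sum.inl j)) + ∑ j, (if i < j then χ (Sum.inr (Sum.inr j)) else 0) =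
        ((∑ j, χ (Sum.inr (Sum.inl j))) + ∑ j, if i < j then χ (Sum.inr (Sum.inr j)) else 0) +
          (∑ j, χ (Sum.inl j) + ∑ j, χ (Sum.inr (Sum.inl j)))
      have h4 := CharTwo.add_self_eq_zero (∑ j, χ (Sum.inr (Sum.inl j)))
      linear_combination - h4
  have htrans : ∀ x y, G.Reachable x y → (χ x = χ y ∧ (χ x = 0 → g x = g y)) := by
    intro x y hxy
    refine glue_induction (S := fun x y => χ x = χ y ∧ (χ x = 0 → g x = g y))
      ⟨fun _ => ⟨rfl, fun _ => rfl⟩, fun h => ⟨h.1.symm, fun k => (h.2 (h.1.trans k)).symm⟩,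
        fun h k => ⟨h.1.trans k.1, fun e => (h.2 e).trans (k.2 (h.1.symm.trans e))⟩⟩ ?_ ?_ hxy
    · intro u v huv
      refine ⟨hχ _ _ (glue_upper huv), fun h0 => ?_⟩
      rw [hgu, hgu]
      exact posSum_eq ha hca _ (fun z t h => hχ _ _ (glue_upper h)) huv h0
    · intro u v huv
      have he := hχ _ _ (glue_lower (a := a) huv)
      refine ⟨he, fun h0 => ?_⟩
      rw [hgl u h0, hgl v (he.symm.trans h0)]
      rw [posSum_eq hb hcb _ (fun z t h => hχ _ _ (glue_lower h)) huv h0]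
  obtain ⟨t, -, ht⟩ := hab p
  have hr : r = t := ht r ⟨fun e => by rw [e] at hqr; omega, hpr⟩
  have hval : ∀ z, χ (outerPt z) = (if z = p then 1 else 0) + (if z = r then 1 else 0) := by
    intro z
    have hne : p ≠ r := fun e => by rw [← e] at hqr; omega
    by_cases hzp : z = p
    · subst hzp
      simp [χ, hne]
    · by_cases hzr : z = r
      · subst hzr
        have : G.Reachable (outerPt p) (outerPt z) := hpr
        simp [χ, hzp, this]
      · have : ¬ G.Reachable (outerPt p) (outerPt z) := fun h =>
          hzr ((ht z ⟨hzp, h⟩).trans hr.symm)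
        simp [χ, hzp, hzr, this]
  have hq0 : χ (outerPt q) = 0 := by
    rw [hval, if_neg (fun e => by rw [e] at hpq; omega), if_neg (fun e => by rw [e] at hqr; omega),
      add_zero]
  have hfin := (htrans _ _ hqs).2 hq0
  rw [hgo, hgo] at hfin
  have hps : ∀ x, posSum (fun z => χ (outerPt z)) x =
      (if bpos p < bpos x then 1 else 0) + (if bpos r < bpos x then 1 else 0) := by
    intro x
    exact posSum_pair (fun e => by rw [← e] at hqr; omega) hval x
  rw [hps, hps, if_pos hpq, if_neg (by omega), if_pos (by omega), if_pos hrs] at hfin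
  revert hfin
  decide

theorem isMatching_id : IsMatching (idDiagram n) := by
  rintro (i | i)
  · refine ⟨Sum.inr i, ⟨by simp, rfl⟩, ?_⟩
    rintro (j | j) ⟨h1, h2⟩
    · have h2 : i = j := h2
      exact absurd (by rw [h2]) h1
    · have h2 : i = j := h2
      rw [h2]
  · refine ⟨Sum.inl i, ⟨by simp, rfl⟩, ?_⟩
    rintro (j | j) ⟨h1, h2⟩
    · have h2 : i = j := h2
      rw [h2]
    · have h2 : i = j := h2
      exact absurd (by rw [h2]) h1

theorem isCrossingless_id : IsCrossingless (idDiagram n) := by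
  rintro (p | p) (q | q) (r | r) (s | s) h1 h2 h3 ⟨h4, h5⟩ <;>
    simp only [bpos, Sum.elim_inl, Sum.elim_inr] at h1 h2 h3 <;>
    (have h4 : p = r := h4
     have h5 : q = s := h5
     subst h4 h5
     omega)

end MatchingFacts

/-- The `m`-cyclic Temperley--Lieb monoid on `n` strands: crossingless matchings, with the number
of internal components counted modulo `m`. -/
def cyclicTL (m n : ℕ) : Submonoid (LoopDiagram m n) where
  carrier := {x | IsMatching x.skel ∧ IsCrossingless x.skel}
  mul_mem' hx hy := ⟨hx.1.stack hy.1, IsCrossingless.stack hx.1 hy.1 hx.2 hy.2⟩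
  one_mem' := ⟨isMatching_id, isCrossingless_id⟩

instance (m n : ℕ) [NeZero m] : Finite (LoopDiagram m n) := by
  have : Finite (Setoid (BPoint n)) :=
    Finite.of_injective (fun a : Setoid (BPoint n) => (fun p q => a p q))
      fun a b h => Setoid.ext fun p q => iff_of_eq (congrFun (congrFun h p) q)
  exact Finite.of_injective (fun x : LoopDiagram m n => (x.skel, x.loops)) fun x y h =>
    LoopDiagram.ext (congrArg Prod.fst h) (congrArg Prod.snd h)

/-- The number of through strands. -/
noncomputable def throughStrands {m n : ℕ} (x : cyclicTL m n) : ℕ :=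
  Nat.card {i : Fin n // ∃ j : Fin n, (x : LoopDiagram m n).skel (Sum.inl i) (Sum.inr j)}

/-- The diagrams with `k` through strands. -/
def throughCell (m n k : ℕ) : Set (cyclicTL m n) := {x | throughStrands x = k}

/-! ### Cell orders, ideals and cell subquotients -/

section Monoids

variable {S : Type*} [Monoid S]

/-- The two-sided cell order: `b` is a two-sided multiple of `a`. -/
def TwoSidedLE (a b : S) : Prop := ∃ c d, b = c * a * d

/-- The elements that lie above (an element of) the cell `J` in the two-sided cell order. -/
def cellsAbove (J : Set S) : Set S := {s | ∃ a ∈ J, TwoSidedLE a s}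

theorem cellsAbove_mul_left {J : Set S} {s : S} (t : S) (hs : s ∈ cellsAbove J) :
    t * s ∈ cellsAbove J := by
  obtain ⟨a, ha, c, d, rfl⟩ := hs
  exact ⟨a, ha, t * c, d, by simp only [mul_assoc]⟩

theorem cellsAbove_mul_right {J : Set S} {s : S} (t : S) (hs : s ∈ cellsAbove J) :
    s * t ∈ cellsAbove J := by
  obtain ⟨a, ha, c, d, rfl⟩ := hs
  exact ⟨a, ha, c, d * t, by simp only [mul_assoc]⟩

/-- The `J`-submonoid: the elements above the cell `J`, together with the identity. -/
def cellSubmonoid (J : Set S) : Submonoid S where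
  carrier := cellsAbove J ∪ {1}
  mul_mem' {x y} hx hy := by
    rcases hx with hx | hx
    · exact Or.inl (cellsAbove_mul_right y hx)
    · rw [Set.mem_singleton_iff.1 hx, one_mul]
      exact hy
  one_mem' := Or.inr rfl

/-- The congruence on the `J`-submonoid that identifies all elements above the cell `K` with each
other and nothing else. -/
def cellCon (J K : Set S) : Con (cellSubmonoid J) where
  r x y := x = y ∨ ((x : S) ∈ cellsAbove K ∧ (y : S) ∈ cellsAbove K)
  iseqv := by
    refine ⟨fun x => Or.inl rfl, ?_, ?_⟩
    · rintro x y (h | h)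
      · exact Or.inl h.symm
      · exact Or.inr ⟨h.2, h.1⟩
    · rintro x y z (rfl | h) (rfl | h')
      · exact Or.inl rfl
      · exact Or.inr h'
      · exact Or.inr h
      · exact Or.inr ⟨h.1, h'.2⟩
  mul' := by
    rintro w x y z (rfl | h) (rfl | h')
    · exact Or.inl rfl
    · exact Or.inr ⟨cellsAbove_mul_left _ h'.1, cellsAbove_mul_left _ h'.2⟩
    · exact Or.inr ⟨cellsAbove_mul_right _ h.1, cellsAbove_mul_right _ h.2⟩
    · exact Or.inr ⟨cellsAbove_mul_right _ h.1, cellsAbove_mul_right _ h.2⟩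

/-- The cell subquotient: the Rees factor of the `J`-submonoid by the ideal of all elements above
`K`, all of which become a zero element. If `K` is empty, this is the `J`-submonoid itself, and
no zero element is added. -/
abbrev CellSubquotient (J K : Set S) : Type _ := (cellCon J K).Quotient

/-! ### Connectedness -/

/-- Every non-invertible element is a product of two non-invertible elements. -/
def IsNullConnected (S : Type*) [Monoid S] : Prop :=
  ∀ a : S, ¬ IsUnit a → ∃ b c : S, ¬ IsUnit b ∧ ¬ IsUnit c ∧ a = b * c

/-- The non-invertible elements form a single class of the equivalence relation generated by
`a * b ≈ a` for non-invertible `a`, `b`. -/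
def IsRightConnected (S : Type*) [Monoid S] : Prop :=
  (∃ a : S, ¬ IsUnit a) ∧ ∀ x y : S, ¬ IsUnit x → ¬ IsUnit y →
    Relation.EqvGen (fun s a : S => ∃ b, ¬ IsUnit a ∧ ¬ IsUnit b ∧ s = a * b) x y

/-- The non-invertible elements form a single class of the equivalence relation generated by
`b * a ≈ a` for non-invertible `a`, `b`. -/
def IsLeftConnected (S : Type*) [Monoid S] : Prop :=
  (∃ a : S, ¬ IsUnit a) ∧ ∀ x y : S, ¬ IsUnit x → ¬ IsUnit y →
    Relation.EqvGen (fun s a : S => ∃ b, ¬ IsUnit a ∧ ¬ IsUnit b ∧ s = b * a) x y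

end Monoids

/-! ### Representations and the representation gap -/

section Representations

variable (K : Type u) [Field K] (S : Type*) [Monoid S] [Finite S]

open Classical in
/-- The characters of the two trivial representations: the one of `𝟙_t` (for `true`) is constantly
`1`; the one of `𝟙_b` (for `false`) is `1` on the group of units and `0` elsewhere. -/
noncomputable def trivialChar (ε : Bool) : S →* K where
  toFun s := if ε = true ∨ IsUnit s then 1 else 0
  map_one' := by simp
  map_mul' s t := by
    have h : IsUnit (s * t) ↔ IsUnit s ∧ IsUnit t := by
      refine ⟨fun h => ?_, fun h => h.1.mul h.2⟩
      obtain ⟨u, hu⟩ := h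
      constructor
      · exact IsUnit.of_mul_eq_one (t * (↑u⁻¹ : S)) (by rw [← mul_assoc, ← hu, Units.mul_inv])
      · exact IsUnit.of_mul_eq_one_right ((↑u⁻¹ : S) * s) (by rw [mul_assoc, ← hu, Units.inv_mul])
    cases ε <;> by_cases hs : IsUnit s <;> by_cases ht : IsUnit t <;> simp [h, hs, ht]

/-- The direct sum of the trivial representations `𝟙_t` (where `ε i = true`) and `𝟙_b` (where
`ε i = false`). -/
noncomputable def trivialSum {r : ℕ} (ε : Fin r → Bool) : Representation K S (Fin r → K) where
  toFun s := LinearMap.pi fun i => trivialChar K S (ε i) s • LinearMap.proj i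
  map_one' := by
    ext
    simp
  map_mul' s t := by
    ext
    simp [mul_assoc]

variable {K S}

/-- The representation is isomorphic to a direct sum of trivial representations. -/
def IsTrivialSum {V : Type u} [AddCommGroup V] [Module K V] (ρ : Representation K S V) : Prop :=
  ∃ (r : ℕ) (ε : Fin r → Bool), Nonempty (ρ.Equiv (trivialSum K S ε))

/-- The representation is isomorphic to one of the two trivial representations. -/
def IsTrivialRep {V : Type u} [AddCommGroup V] [Module K V] (ρ : Representation K S V) : Prop :=
  ∃ ε : Fin 1 → Bool, Nonempty (ρ.Equiv (trivialSum K S ε))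

variable (K S)

/-- The pair `(S, K)` is `r`-trivial: every representation of dimension at most `r` is a direct sum
of trivial ones. By convention, the trivial monoid and the monoid `{1, a}` with `a ^ 2 = a`
(that is, the trivial group with a zero adjoined) are only `(-1)`-trivial. -/
def IsTrivialPair (r : ℤ) : Prop :=
  (0 ≤ r → IsEmpty (S ≃* Unit) ∧ IsEmpty (S ≃* WithZero Unit)) ∧
  ∀ (V : Type u) [AddCommGroup V] [Module K V] [Module.Finite K V] (ρ : Representation K S V),
    (Module.finrank K V : ℤ) ≤ r → IsTrivialSum ρ

/-- `g` is the representation gap of `(S, K)`: the greatest `r` such that `(S, K)` is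
`(r - 1)`-trivial. -/
def IsRepresentationGap (g : ℕ) : Prop :=
  IsGreatest {r : ℕ | IsTrivialPair K S ((r : ℤ) - 1)} g

/-- The dimensions of the simple representations that are not isomorphic to a trivial one. -/
def nontrivialSimpleDims : Set ℕ :=
  {d | ∃ (V : Type u) (_ : AddCommGroup V) (_ : Module K V) (_ : Module.Finite K V)
    (ρ : Representation K S V), ρ.IsIrreducible ∧ ¬ IsTrivialRep ρ ∧ Module.finrank K V = d}

end Representations

/-! ### The truncated monoid -/

/-- The truncated cyclic Temperley--Lieb monoid: diagrams with at most `l` through strands and the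
identity, where all diagrams with fewer than `k` through strands are identified to a zero element
(for `k < 2` there are none, and no zero element is added). -/
abbrev TruncatedTL (m n k l : ℕ) : Type :=
  CellSubquotient (throughCell m n l) {x : cyclicTL m n | throughStrands x + 2 = k}

instance (m n k l : ℕ) [NeZero m] : Finite (TruncatedTL m n k l) :=
  Finite.of_surjective _ Quotient.mk_surjective

/-! The representation theory is formal. Suppose that all simple representations of dimension at
most `r` are trivial. Then, in any representation of dimension at most `r`, the units act by `1` and
all non-units act by one operator `e`. This goes by induction on the dimension: there is an
eigenvector `w` spanning a copy of 𝟙_t or 𝟙_b, and the claim holds modulo `w`. A unit satisfies `s ^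
m = 1` and acts unipotently, hence trivially, since `m` is invertible in the field. If the non-units
kill `w`, the action of `a * b` does not depend on the non-unit `b`, and null- and
right-connectedness make the action of non-units constant. If they fix `w`, then `a ↦ ρ (a * c) - ρ
c` is additive for a fixed non-unit `c`, hence zero because there are no homomorphisms to `(K, +)`,
and left-connectedness finishes (`eq_of_not_isUnit_of_extension`). As `e` is idempotent, the
representation is a sum of trivial ones. So the gap is the least dimension of a nontrivial simple
representation; one exists because functions on the monoid separate two non-units
(`exists_isRepresentationGap`).

The combinatorics takes place among skeletons. A skeleton is determined by its two-colourings, and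
stacking composes them as relations; this yields the Temperley–Lieb relations. The ideals generated
by the idempotents `tail c` form the filtration by the number of through strands, because a cup can
be shifted to the right by multiplications that can be undone (`exists_move_cup`). With a zero
element, connectedness is immediate. Without one, it is inherited from the ideal of `tail c` by that
of `tail (c + 1)`: everything reduces to comparing two cup-caps at positions left of the `c` cups,
and distant cup-caps commute (`leftRel_cupCap`). This needs five free positions, so three must
remain after the step: hence the condition `l ≥ 3` and the two exceptions with `l = n`, where the
ideal of non-units is that of `tail 1`.

Loops are harmless since their number lives in a group: equations between skeletons lift to
diagrams. A diagram with idempotent skeleton satisfies `x ^ (m + 1) = x`, so additive characters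
vanish on it; in the lowest cell `tail d * x * tail d = tail d`, so they vanish everywhere
(`hom_eq_one`). -/

/-! ### Stacking as composition of two-colouring relations -/

/-- The number of intermediate colourings is a power of two by `colour_count`, hence never zero.
Identities between stacks thereby become statements about Boolean functions. -/
theorem colours_stack {n : ℕ} {a b : Setoid (BPoint n)} {f g : Fin n → Bool} :
    Colours (stack a b) f g ↔ ∃ h, Colours a f h ∧ Colours b h g := by
  constructor
  · intro hc
    have h := colour_count a b f g hc
    have hpos : 0 < Nat.card {h : Fin n → Bool // Colours a f h ∧ Colours b h g} := by
      rw [h]; positivity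
    obtain ⟨h, hh⟩ := (Nat.card_pos_iff.1 hpos).1
    exact ⟨h, hh⟩
  · rintro ⟨h, ha, hb⟩ p q hpq
    have := colours_glue ha hb hpq
    rwa [elim_outer, elim_outer] at this

theorem ext_of_colours {n : ℕ} {a b : Setoid (BPoint n)}
    (h : ∀ f g, Colours a f g ↔ Colours b f g) : a = b := by
  classical
  apply colourMatrix_inj
  ext f g
  simp [colourMatrix, h]

/-- Crossingless matchings, without the number of internal components. -/
abbrev Skeleton (n : ℕ) : Type := {a : Setoid (BPoint n) // IsMatching a ∧ IsCrossingless a}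

/-! ### The Temperley–Lieb monoid without loops -/

namespace Skeleton

variable {n : ℕ}

noncomputable instance : Monoid (Skeleton n) where
  mul x y := ⟨stack x.1 y.1, x.2.1.stack y.2.1, IsCrossingless.stack x.2.1 y.2.1 x.2.2 y.2.2⟩
  one := ⟨idDiagram n, isMatching_id, isCrossingless_id⟩
  mul_assoc x y z := Subtype.ext (stack_assoc x.1 y.1 z.1).2
  one_mul x := Subtype.ext (id_stack x.1).2
  mul_one x := Subtype.ext (stack_id x.1).2

instance : Finite (Skeleton n) :=
  Finite.of_injective (fun a : Skeleton n => (fun p q => a.1 p q))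
    fun _ _ h => Subtype.ext (Setoid.ext fun p q => iff_of_eq (congrFun (congrFun h p) q))

theorem colours_mul {x y : Skeleton n} {f g : Fin n → Bool} :
    Colours (x * y).1 f g ↔ ∃ h, Colours x.1 f h ∧ Colours y.1 h g := colours_stack

theorem ext_colours {x y : Skeleton n} (h : ∀ f g, Colours x.1 f g ↔ Colours y.1 f g) : x = y :=
  Subtype.ext (ext_of_colours h)

/-- A strand of a matching determines its end points. -/
theorem partner_unique (x : Skeleton n) {p q r : BPoint n} (hq : x.1 p q) (hr : x.1 p r)
    (hqp : q ≠ p) (hrp : r ≠ p) : q = r :=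
  (x.2.1 p).unique ⟨hqp, hq⟩ ⟨hrp, hr⟩

theorem exists_partner (x : Skeleton n) (p : BPoint n) : ∃ q, q ≠ p ∧ x.1 p q :=
  (x.2.1 p).exists

/-! ### The flip -/

theorem bpos_swap (p : BPoint n) : bpos p.swap = 2 * n - 1 - bpos p := by
  rcases p with i | i <;> simp only [bpos, Sum.swap_inl, Sum.swap_inr, Sum.elim_inl, Sum.elim_inr]
  omega

/-- The reflection of a diagram in a horizontal axis. -/
def flip (x : Skeleton n) : Skeleton n :=
  ⟨Setoid.comap Sum.swap x.1, by
    intro p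
    obtain ⟨q, ⟨h1, h2⟩, h3⟩ := x.2.1 p.swap
    refine ⟨q.swap, ⟨fun e => h1 (by rw [← e, Sum.swap_swap]), ?_⟩, ?_⟩
    · change x.1 p.swap q.swap.swap
      rwa [Sum.swap_swap]
    · rintro r ⟨h4, h5⟩
      rw [← h3 r.swap ⟨fun e => h4 (by rw [← Sum.swap_swap r, e, Sum.swap_swap]), h5⟩,
        Sum.swap_swap],
   by
    rintro p q r s h1 h2 h3 ⟨h4, h5⟩
    have h4 : x.1 p.swap r.swap := h4
    have h5 : x.1 q.swap s.swap := h5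
    have hb : ∀ t : BPoint n, bpos t < 2 * n := by
      rintro (i | i) <;> simp only [bpos, Sum.elim_inl, Sum.elim_inr] <;> omega
    have := hb p; have := hb q; have := hb r; have := hb s
    refine x.2.2 s.swap r.swap q.swap p.swap ?_ ?_ ?_ ⟨x.1.symm' h5, x.1.symm' h4⟩ <;>
      rw [bpos_swap, bpos_swap] <;> omega⟩

theorem flip_rel (x : Skeleton n) (p q : BPoint n) : (flip x).1 p q ↔ x.1 p.swap q.swap := Iff.rfl

theorem flip_flip (x : Skeleton n) : flip (flip x) = x := by
  apply Subtype.ext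
  ext p q
  change x.1 p.swap.swap q.swap.swap ↔ _
  rw [Sum.swap_swap, Sum.swap_swap]

theorem colours_flip {x : Skeleton n} {f g : Fin n → Bool} :
    Colours (flip x).1 f g ↔ Colours x.1 g f := by
  have key : ∀ p : BPoint n, (Sum.elim g f p.swap : Bool) = Sum.elim f g p := by
    rintro (p | p) <;> rfl
  constructor
  · intro h p q hpq
    have := h p.swap q.swap (by rw [flip_rel, Sum.swap_swap, Sum.swap_swap]; exact hpq)
    rwa [← key, ← key, Sum.swap_swap, Sum.swap_swap] at this
  · intro h p q hpq
    have := h p.swap q.swap hpq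
    rwa [key, key] at this

theorem flip_mul (x y : Skeleton n) : flip (x * y) = flip y * flip x := by
  apply ext_colours
  intro f g
  rw [colours_flip, colours_mul, colours_mul]
  simp only [colours_flip]
  exact ⟨fun ⟨h, h1, h2⟩ => ⟨h, h2, h1⟩, fun ⟨h, h1, h2⟩ => ⟨h, h2, h1⟩⟩

theorem flip_one : flip (1 : Skeleton n) = 1 := by
  have h := flip_mul (1 : Skeleton n) (flip 1)
  rwa [flip_flip, one_mul, flip_flip, eq_comm] at h

/-! ### The generators -/

/-- The labels of the strands of a cup-cap diagram. -/
def cupCapLabel (n j : ℕ) : BPoint n → ℕ :=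
  Sum.elim (fun i => if (i : ℕ) = j ∨ (i : ℕ) = j + 1 then 0 else i + 2)
    (fun i => if (i : ℕ) = j ∨ (i : ℕ) = j + 1 then 1 else i + 2)

open Classical in
/-- The diagram with a cup and a cap at the positions `j` and `j + 1` and vertical strands
elsewhere. -/
noncomputable def cupCap (j : ℕ) : Skeleton n :=
  if hj : j + 1 < n then
    ⟨Setoid.ker (cupCapLabel n j), by
      have key : ∀ p q : BPoint n, q ≠ p → cupCapLabel n j p = cupCapLabel n j q →
          (∀ r, r ≠ p ∧ cupCapLabel n j p = cupCapLabel n j r → r = q) →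
          ∃! q, q ≠ p ∧ Setoid.ker (cupCapLabel n j) p q :=
        fun p q h1 h2 h3 => ⟨q, ⟨h1, h2⟩, h3⟩
      rintro (i | i)
      · by_cases h1 : (i : ℕ) = j
        · apply key _ (Sum.inl ⟨j + 1, hj⟩)
          · simp [Fin.ext_iff]; omega
          · simp [cupCapLabel, h1]
          · rintro (k | k) ⟨h2, h3⟩ <;>
              simp only [cupCapLabel, Sum.elim_inl, Sum.elim_inr, ne_eq, Sum.inl.injEq,
                reduceCtorEq, Fin.ext_iff] at h2 h3 ⊢ <;>
              split_ifs at h3 <;> omega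
        · by_cases h1' : (i : ℕ) = j + 1
          · apply key _ (Sum.inl ⟨j, by omega⟩)
            · simp [Fin.ext_iff]; omega
            · simp [cupCapLabel, h1']
            · rintro (k | k) ⟨h2, h3⟩ <;>
                simp only [cupCapLabel, Sum.elim_inl, Sum.elim_inr, ne_eq, Sum.inl.injEq,
                  reduceCtorEq, Fin.ext_iff] at h2 h3 ⊢ <;>
                split_ifs at h3 <;> omega
          · apply key _ (Sum.inr i)
            · simp
            · simp [cupCapLabel, h1, h1']
            · rintro (k | k) ⟨h2, h3⟩ <;>
                simp only [cupCapLabel, Sum.elim_inl, Sum.elim_inr, ne_eq, Sum.inl.injEq,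
                  Sum.inr.injEq, reduceCtorEq, Fin.ext_iff] at h2 h3 ⊢ <;>
                split_ifs at h3 <;> omega
      · by_cases h1 : (i : ℕ) = j
        · apply key _ (Sum.inr ⟨j + 1, hj⟩)
          · simp [Fin.ext_iff]; omega
          · simp [cupCapLabel, h1]
          · rintro (k | k) ⟨h2, h3⟩ <;>
              simp only [cupCapLabel, Sum.elim_inl, Sum.elim_inr, ne_eq,
                Sum.inr.injEq, reduceCtorEq, Fin.ext_iff] at h2 h3 ⊢ <;>
              split_ifs at h3 <;> omega
        · by_cases h1' : (i : ℕ) = j + 1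
          · apply key _ (Sum.inr ⟨j, by omega⟩)
            · simp [Fin.ext_iff]; omega
            · simp [cupCapLabel, h1']
            · rintro (k | k) ⟨h2, h3⟩ <;>
                simp only [cupCapLabel, Sum.elim_inl, Sum.elim_inr, ne_eq,
                  Sum.inr.injEq, reduceCtorEq, Fin.ext_iff] at h2 h3 ⊢ <;>
                split_ifs at h3 <;> omega
          · apply key _ (Sum.inl i)
            · simp
            · simp [cupCapLabel, h1, h1']
            · rintro (k | k) ⟨h2, h3⟩ <;>
                simp only [cupCapLabel, Sum.elim_inl, Sum.elim_inr, ne_eq, Sum.inl.injEq,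
                  Sum.inr.injEq, reduceCtorEq, Fin.ext_iff] at h2 h3 ⊢ <;>
                split_ifs at h3 <;> omega,
     by
      rintro (p | p) (q | q) (r | r) (s | s) h1 h2 h3 ⟨h4, h5⟩ <;>
        simp only [Setoid.ker_def, cupCapLabel, bpos, Sum.elim_inl, Sum.elim_inr] at * <;>
        split_ifs at h4 h5 <;> omega⟩
  else 1

theorem cupCap_rel {j : ℕ} (hj : j + 1 < n) (p q : BPoint n) :
    (cupCap j : Skeleton n).1 p q ↔ cupCapLabel n j p = cupCapLabel n j q := by
  rw [cupCap, dif_pos hj]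
  rfl

theorem cupCap_inl_inl {j : ℕ} (hj : j + 1 < n) :
    (cupCap j : Skeleton n).1 (Sum.inl ⟨j, by omega⟩) (Sum.inl ⟨j + 1, hj⟩) := by
  rw [cupCap_rel hj]; simp [cupCapLabel]

theorem cupCap_inr_inr {j : ℕ} (hj : j + 1 < n) :
    (cupCap j : Skeleton n).1 (Sum.inr ⟨j, by omega⟩) (Sum.inr ⟨j + 1, hj⟩) := by
  rw [cupCap_rel hj]; simp [cupCapLabel]

theorem cupCap_inl_inr {j : ℕ} (hj : j + 1 < n) (i : Fin n) (h1 : (i : ℕ) ≠ j)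
    (h2 : (i : ℕ) ≠ j + 1) : (cupCap j : Skeleton n).1 (Sum.inl i) (Sum.inr i) := by
  rw [cupCap_rel hj]; simp [cupCapLabel, h1, h2]

theorem colours_cupCap {j : ℕ} (hj : j + 1 < n) {f g : Fin n → Bool} :
    Colours (cupCap j : Skeleton n).1 f g ↔ f ⟨j, by omega⟩ = f ⟨j + 1, hj⟩ ∧
      g ⟨j, by omega⟩ = g ⟨j + 1, hj⟩ ∧ ∀ i : Fin n, (i : ℕ) ≠ j → (i : ℕ) ≠ j + 1 → f i = g i := by
  constructor
  · intro h
    exact ⟨h _ _ (cupCap_inl_inl hj), h _ _ (cupCap_inr_inr hj),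
      fun i h1 h2 => h _ _ (cupCap_inl_inr hj i h1 h2)⟩
  · rintro ⟨h1, h2, h3⟩ p q hpq
    rw [cupCap_rel hj] at hpq
    have hf : ∀ i : Fin n, (i : ℕ) = j ∨ (i : ℕ) = j + 1 → f i = f ⟨j, by omega⟩ := by
      rintro i (h | h)
      · congr 1; exact Fin.ext h
      · rw [h1]; congr 1; exact Fin.ext h
    have hg : ∀ i : Fin n, (i : ℕ) = j ∨ (i : ℕ) = j + 1 → g i = g ⟨j, by omega⟩ := by
      rintro i (h | h)
      · congr 1; exact Fin.ext h
      · rw [h2]; congr 1; exact Fin.ext h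
    rcases p with p | p <;> rcases q with q | q <;>
      simp only [cupCapLabel, Sum.elim_inl, Sum.elim_inr] at hpq ⊢ <;> split_ifs at hpq with h4 h5
    all_goals first
      | omega
      | rw [hf _ h4, hf _ h5]
      | rw [hg _ h4, hg _ h5]
      | (have e : p = q := Fin.ext (by omega)
         subst e
         first
           | rfl
           | exact h3 _ (by tauto) (by tauto)
           | exact (h3 _ (by tauto) (by tauto)).symm)

/-- A cup at the bottom of a diagram absorbs the corresponding generator. -/
theorem mul_cupCap_of_rel {j : ℕ} (hj : j + 1 < n) {x : Skeleton n}
    (hx : x.1 (Sum.inr ⟨j, by omega⟩) (Sum.inr ⟨j + 1, hj⟩)) : x * cupCap j = x := by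
  apply ext_colours
  intro f g
  rw [colours_mul]
  constructor
  · rintro ⟨h, h1, h2⟩
    obtain ⟨h3, h4, h5⟩ := (colours_cupCap hj).1 h2
    have hblock : ∀ (i : Fin n) (q : BPoint n), (i : ℕ) = j ∨ (i : ℕ) = j + 1 → x.1 (Sum.inr i) q →
        q = Sum.inr ⟨j, by omega⟩ ∨ q = Sum.inr ⟨j + 1, hj⟩ := by
      rintro i q (hi | hi) hq
      · rw [show i = ⟨j, by omega⟩ from Fin.ext hi] at hq
        by_cases e : q = Sum.inr ⟨j, by omega⟩
        · exact Or.inl e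
        · exact Or.inr (x.partner_unique hq hx e (by simp))
      · rw [show i = ⟨j + 1, hj⟩ from Fin.ext hi] at hq
        by_cases e : q = Sum.inr ⟨j + 1, hj⟩
        · exact Or.inr e
        · exact Or.inl (x.partner_unique hq (x.1.symm' hx) e (by simp))
    have hval : ∀ q : BPoint n, q = Sum.inr ⟨j, by omega⟩ ∨ q = Sum.inr ⟨j + 1, hj⟩ ∨
        (Sum.elim f g q : Bool) = Sum.elim f h q := by
      rintro (i | i)
      · exact Or.inr (Or.inr rfl)
      · by_cases h6 : (i : ℕ) = j
        · left; congr 1; exact Fin.ext h6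
        · by_cases h7 : (i : ℕ) = j + 1
          · right; left; congr 1; exact Fin.ext h7
          · right; right; exact (h5 i h6 h7).symm
    intro p q hpq
    rcases hval p with rfl | rfl | hp
    · rcases hblock _ q (Or.inl rfl) hpq with rfl | rfl
      · rfl
      · exact h4
    · rcases hblock _ q (Or.inr rfl) hpq with rfl | rfl
      · exact h4.symm
      · rfl
    · rcases hval q with rfl | rfl | hq
      · rcases hblock _ p (Or.inl rfl) (x.1.symm' hpq) with rfl | rfl
        · rfl
        · exact h4.symm
      · rcases hblock _ p (Or.inr rfl) (x.1.symm' hpq) with rfl | rfl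
        · exact h4
        · rfl
      · rw [hp, hq]; exact h1 p q hpq
  · intro hc
    exact ⟨g, hc, (colours_cupCap hj).2 ⟨hc _ _ hx, hc _ _ hx, fun _ _ _ => rfl⟩⟩

theorem cupCap_mul_self {j : ℕ} (hj : j + 1 < n) :
    (cupCap j : Skeleton n) * cupCap j = cupCap j :=
  mul_cupCap_of_rel hj (cupCap_inr_inr hj)

theorem flip_cupCap {j : ℕ} (hj : j + 1 < n) : flip (cupCap j : Skeleton n) = cupCap j := by
  apply ext_colours
  intro f g
  rw [colours_flip, colours_cupCap hj, colours_cupCap hj]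
  exact ⟨fun ⟨h1, h2, h3⟩ => ⟨h2, h1, fun i h4 h5 => (h3 i h4 h5).symm⟩,
    fun ⟨h1, h2, h3⟩ => ⟨h2, h1, fun i h4 h5 => (h3 i h4 h5).symm⟩⟩

theorem cupCap_braid_of_adjacent {i j : ℕ} (hi : i + 1 < n) (hj : j + 1 < n)
    (hij : i = j + 1 ∨ j = i + 1) :
    (cupCap i : Skeleton n) * cupCap j * cupCap i = cupCap i := by
  apply ext_colours
  intro f g
  rw [colours_mul]
  simp only [colours_mul, colours_cupCap hi, colours_cupCap hj]
  constructor
  · rintro ⟨h, ⟨k, ⟨h1, h2, h3⟩, h4, h5, h6⟩, h7, h8, h9⟩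
    refine ⟨h1, h8, fun t ht1 ht2 => ?_⟩
    by_cases ht : (t : ℕ) ≠ j ∧ (t : ℕ) ≠ j + 1
    · rw [h3 t ht1 ht2, h6 t ht.1 ht.2, h9 t ht1 ht2]
    · rw [h3 t ht1 ht2, ← h9 t ht1 ht2]
      rcases hij with rfl | rfl
      · have e1 : t = ⟨j, by omega⟩ := Fin.ext (by simp; omega)
        rw [e1, h4, h2, h6 _ (by simp; omega) (by simp), ← h7, ← h5]
      · have e1 : t = ⟨i + 1 + 1, hj⟩ := Fin.ext (by simp; omega)
        rw [e1, ← h4, ← h2, h6 _ (by simp) (by simp; omega), h7, h5]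
  · rintro ⟨h1, h2, h3⟩
    -- The three layers form a zigzag that carries the colour of the one point of `{j, j + 1}`
    -- outside `{i, i + 1}`. Both intermediate colourings take this colour at `i` and `i + 1`.
    let c : Bool := if h : i = j + 1 then f ⟨j, by omega⟩ else f ⟨j + 1, hj⟩
    have hc1 : ∀ t : Fin n, (t : ℕ) = j ∨ (t : ℕ) = j + 1 → (t : ℕ) ≠ i → (t : ℕ) ≠ i + 1 →
        f t = c := by
      intro t ht ht1 ht2
      simp only [c]
      split_ifs with e
      · congr 1; exact Fin.ext (by simp only; omega)
      · congr 1; exact Fin.ext (by simp only; omega)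
    let h : Fin n → Bool := fun t => if (t : ℕ) = i ∨ (t : ℕ) = i + 1 then c else f t
    have hh : h ⟨j, by omega⟩ = h ⟨j + 1, hj⟩ := by
      simp only [h]
      rcases hij with e | e
      · rw [if_neg (by omega), if_pos (by omega)]
        exact hc1 _ (by simp) (by simp; omega) (by simp; omega)
      · rw [if_pos (by omega), if_neg (by omega)]
        exact (hc1 _ (by simp) (by simp; omega) (by simp; omega)).symm
    refine ⟨h, ⟨h, ⟨h1, by simp [h], fun t h4 h5 => by simp [h, h4, h5]⟩, hh, hh, fun _ _ _ => rfl⟩,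
      by simp [h], h2, fun t h4 h5 => by simp [h, h4, h5, h3 t h4 h5]⟩

theorem cupCap_comm {i j : ℕ} (hij : i + 2 ≤ j) (hj : j + 1 < n) :
    (cupCap i : Skeleton n) * cupCap j = cupCap j * cupCap i := by
  have hi : i + 1 < n := by omega
  have key : ∀ {i j : ℕ} (hi : i + 1 < n) (hj : j + 1 < n), i + 2 ≤ j ∨ j + 2 ≤ i →
      ∀ f g, Colours ((cupCap i : Skeleton n) * cupCap j).1 f g →
        Colours ((cupCap j : Skeleton n) * cupCap i).1 f g := by
    intro i j hi hj hij f g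
    simp only [colours_mul, colours_cupCap hi, colours_cupCap hj]
    rintro ⟨h, ⟨h1, h2, h3⟩, h4, h5, h6⟩
    -- After the factor at `j` alone, the colours at `j` and `j + 1` are already those of `g`, and
    -- all others are still those of `f`.
    refine ⟨fun t => if (t : ℕ) = j ∨ (t : ℕ) = j + 1 then g t else f t,
      ⟨?_, ?_, ?_⟩, ?_, ?_, ?_⟩
    · rw [h3 _ (by simp; omega) (by simp; omega), h3 _ (by simp; omega) (by simp; omega), h4]
    · simpa using h5
    · intro t ht1 ht2
      simp [ht1, ht2]
    · simp only
      rw [if_neg (by omega), if_neg (by omega), h1]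
    · rw [← h6 _ (by simp; omega) (by simp; omega), ← h6 _ (by simp; omega) (by simp; omega), h2]
    · intro t ht1 ht2
      dsimp only
      split_ifs with ht
      · rfl
      · rw [h3 t ht1 ht2, h6 t (by tauto) (by tauto)]
  exact ext_colours fun f g => ⟨key hi hj (Or.inl hij) f g, key hj hi (Or.inr hij) f g⟩

end Skeleton

namespace Skeleton

variable {n : ℕ}

/-- Blocks of a matching have exactly two points, so one matching cannot properly refine another. -/
theorem eq_of_le {x y : Skeleton n} (h : ∀ p q, x.1 p q → y.1 p q) : x = y := by
  apply Subtype.ext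
  ext p q
  refine ⟨h p q, fun hy => ?_⟩
  by_cases e : q = p
  · rw [e]
  · obtain ⟨r, hr, hxr⟩ := x.exists_partner p
    rw [y.partner_unique hy (h p r hxr) e hr]
    exact hxr

/-! ### The number of through strands -/

/-- The number of through strands. -/
noncomputable def rank (x : Skeleton n) : ℕ :=
  Nat.card {i : Fin n // ∃ j : Fin n, x.1 (Sum.inl i) (Sum.inr j)}

theorem rank_mul_le (x y : Skeleton n) : rank (x * y) ≤ rank x := by
  classical
  refine Nat.card_le_card_of_injective (Subtype.map id ?_)
    (Subtype.map_injective _ Function.injective_id)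
  rintro i ⟨j, hij⟩
  by_contra hno
  push Not at hno
  -- If the strand of `x` at the top point `i` returned to the top, colouring it `true` and all else
  -- `false` would extend by `false` through `y`. Then `i` and the bottom point `j` would differ in
  -- colour although `x * y` connects them.
  let f : Fin n → Bool := fun t => decide (x.1 (Sum.inl i) (Sum.inl t))
  have hf : ∀ p : BPoint n, (Sum.elim f (fun _ => false) p : Bool) =
      decide (x.1 (Sum.inl i) p) := by
    rintro (p | p)
    · rfl
    · simpa using hno p
  have h1 : Colours x.1 f (fun _ => false) := by
    intro p q hpq
    rw [hf, hf, decide_eq_decide]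
    exact ⟨fun h => x.1.trans' h hpq, fun h => x.1.trans' h (x.1.symm' hpq)⟩
  have h2 : Colours y.1 (fun _ => false) (fun _ => false) := by
    rintro (p | p) (q | q) _ <;> rfl
  have h3 := colours_mul.2 ⟨_, h1, h2⟩ _ _ hij
  simp [f] at h3

theorem rank_le_rank_flip (x : Skeleton n) : rank x ≤ rank (flip x) := by
  choose τ hτ using fun i : {i : Fin n // ∃ j : Fin n, x.1 (Sum.inl i) (Sum.inr j)} => i.2
  refine Nat.card_le_card_of_injective (fun i => ⟨τ i, i.1, x.1.symm' (hτ i)⟩) fun i j hij => ?_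
  have e : τ i = τ j := congrArg Subtype.val hij
  have hj := hτ j
  rw [← e] at hj
  have := x.partner_unique (x.1.symm' (hτ i)) (x.1.symm' hj) (by simp) (by simp)
  exact Subtype.ext (Sum.inl_injective this)

theorem rank_flip (x : Skeleton n) : rank (flip x) = rank x := by
  refine le_antisymm ?_ (rank_le_rank_flip x)
  have := rank_le_rank_flip (flip x)
  rwa [flip_flip] at this

theorem card_lt_subtype {m : ℕ} (hm : m ≤ n) : Nat.card {i : Fin n // (i : ℕ) < m} = m := by
  rw [Nat.card_congr (β := Fin m) ⟨fun i => ⟨i.1, i.2⟩, fun i => ⟨⟨i, by omega⟩, i.2⟩,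
    fun _ => rfl, fun _ => rfl⟩, Nat.card_eq_fintype_card, Fintype.card_fin]

/-- If every top point starts a through strand, planarity makes the assignment of bottom points
strictly increasing, and the only such self-map of `Fin n` is the identity. -/
theorem eq_one_of_rank {x : Skeleton n} (hx : rank x = n) : x = 1 := by
  classical
  have hall : ∀ i : Fin n, ∃ j : Fin n, x.1 (Sum.inl i) (Sum.inr j) := by
    have h1 : (Finset.univ.filter fun i : Fin n => ∃ j : Fin n, x.1 (Sum.inl i) (Sum.inr j)).card =
        (Finset.univ : Finset (Fin n)).card := by
      rw [rank, Nat.card_eq_fintype_card, Fintype.card_subtype] at hx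
      simpa using hx
    have h2 := Finset.eq_of_subset_of_card_le (Finset.filter_subset _ _) h1.ge
    intro i
    have := Finset.mem_univ i
    rw [← h2] at this
    exact (Finset.mem_filter.1 this).2
  choose τ hτ using hall
  have hmono : StrictMono τ := by
    intro i j hij
    by_contra hle
    rcases (not_lt.1 hle).lt_or_eq with h | h
    · refine x.2.2 (Sum.inl i) (Sum.inl j) (Sum.inr (τ i)) (Sum.inr (τ j)) ?_ ?_ ?_ ⟨hτ i, hτ j⟩ <;>
        simp only [bpos, Sum.elim_inl, Sum.elim_inr] <;> omega
    · have hj := hτ j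
      rw [h] at hj
      have := x.partner_unique (x.1.symm' (hτ i)) (x.1.symm' hj) (by simp) (by simp)
      exact hij.ne (Sum.inl_injective this)
  have hid : ∀ i, τ i = i := fun i => le_antisymm hmono.apply_le hmono.le_apply
  symm
  refine eq_of_le fun p q hpq => ?_
  have hpq : (Sum.elim id id p : Fin n) = Sum.elim id id q := hpq
  have hτ' : ∀ i, x.1 (Sum.inl i) (Sum.inr i) := fun i => by
    have := hτ i
    rwa [hid] at this
  rcases p with p | p <;> rcases q with q | q <;>
    (simp only [Sum.elim_inl, Sum.elim_inr, id_eq] at hpq; subst hpq)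
  · exact x.1.iseqv.refl _
  · exact hτ' p
  · exact x.1.symm' (hτ' p)
  · exact x.1.iseqv.refl _

/-! ### Idempotents with cups and caps at the right end -/

/-- The diagram with `c` cups and caps next to each other at the right end and `n - 2 * c` vertical
strands to the left of them. -/
noncomputable def tail : ℕ → Skeleton n
  | 0 => 1
  | c + 1 => cupCap (n - 2 * c - 2) * tail c

theorem tail_succ (c : ℕ) : (tail (c + 1) : Skeleton n) = cupCap (n - 2 * c - 2) * tail c := rfl

/-- The generator sits to the left of all cups of `tail c`, so only commutations of distant
generators are needed. -/
theorem cupCap_mul_tail {c j : ℕ} (hj : j + 2 + 2 * c ≤ n) :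
    (cupCap j : Skeleton n) * tail c = tail c * cupCap j := by
  induction c with
  | zero => rw [tail, one_mul, mul_one]
  | succ c ih =>
    rw [tail_succ, ← mul_assoc, cupCap_comm (by omega) (by omega), mul_assoc, ih (by omega),
      mul_assoc]

theorem tail_mul_self {c : ℕ} (hc : 2 * c ≤ n) : (tail c : Skeleton n) * tail c = tail c := by
  induction c with
  | zero => rw [tail, one_mul]
  | succ c ih =>
    rw [tail_succ, mul_assoc, ← mul_assoc (tail c), ← cupCap_mul_tail (by omega), mul_assoc,
      ih (by omega), ← mul_assoc, cupCap_mul_self (by omega)]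

theorem flip_tail {c : ℕ} (hc : 2 * c ≤ n) : flip (tail c : Skeleton n) = tail c := by
  induction c with
  | zero => rw [tail, flip_one]
  | succ c ih =>
    rw [tail_succ, flip_mul, flip_cupCap (by omega), ih (by omega), cupCap_mul_tail (by omega)]

theorem tail_inl_inr {c : ℕ} (i : Fin n) (hi : (i : ℕ) + 2 * c < n) :
    (tail c : Skeleton n).1 (Sum.inl i) (Sum.inr i) := by
  induction c with
  | zero => exact rfl
  | succ c ih =>
    exact (glue_upper (cupCap_inl_inr (by omega) i (by omega) (by omega))).trans
      (glue_lower (ih (by omega)))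

theorem tail_inl_inl {c : ℕ} (hc : 2 * c ≤ n) (i : Fin n) (hi : n ≤ (i : ℕ) + 2 * c) :
    ∃ j : Fin n, j ≠ i ∧ n ≤ (j : ℕ) + 2 * c ∧
      (tail c : Skeleton n).1 (Sum.inl i) (Sum.inl j) := by
  induction c with
  | zero => omega
  | succ c ih =>
    by_cases h : n ≤ (i : ℕ) + 2 * c
    · obtain ⟨j, h1, h2, h3⟩ := ih (by omega) h
      refine ⟨j, h1, by omega, ?_⟩
      have hv : ∀ t : Fin n, n ≤ (t : ℕ) + 2 * c →
          (cupCap (n - 2 * c - 2) : Skeleton n).1 (Sum.inl t) (Sum.inr t) := fun t ht =>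
        cupCap_inl_inr (by omega) t (by omega) (by omega)
      exact ((glue_upper (hv i h)).trans (glue_lower h3)).trans (glue_upper (hv j h2)).symm
    · have hu := glue_upper (b := (tail c : Skeleton n).1)
        (cupCap_inl_inl (n := n) (j := n - 2 * c - 2) (by omega))
      by_cases h' : (i : ℕ) = n - 2 * c - 2
      · refine ⟨⟨n - 2 * c - 2 + 1, by omega⟩, ?_, ?_, ?_⟩
        · simp only [ne_eq, Fin.ext_iff]; omega
        · simp only; omega
        · obtain ⟨i, hi'⟩ := i
          obtain rfl : i = n - 2 * c - 2 := h'
          exact hu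
      · refine ⟨⟨n - 2 * c - 2, by omega⟩, ?_, ?_, ?_⟩
        · simp only [ne_eq, Fin.ext_iff]; omega
        · simp only; omega
        · obtain ⟨i, hi'⟩ := i
          obtain rfl : i = n - 2 * c - 2 + 1 := by simp only at hi h h'; omega
          exact hu.symm

theorem tail_inr_inr {c : ℕ} (hc : 2 * c ≤ n) (i : Fin n) (hi : n ≤ (i : ℕ) + 2 * c) :
    ∃ j : Fin n, j ≠ i ∧ n ≤ (j : ℕ) + 2 * c ∧
      (tail c : Skeleton n).1 (Sum.inr i) (Sum.inr j) := by
  have h := tail_inl_inl hc i hi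
  rwa [← flip_tail hc] at h

theorem mul_tail_inr_inr {c : ℕ} (hc : 2 * c ≤ n) (x : Skeleton n) (i : Fin n)
    (hi : n ≤ (i : ℕ) + 2 * c) :
    ∃ j : Fin n, j ≠ i ∧ n ≤ (j : ℕ) + 2 * c ∧ (x * tail c).1 (Sum.inr i) (Sum.inr j) := by
  obtain ⟨j, h1, h2, h3⟩ := tail_inr_inr hc i hi
  exact ⟨j, h1, h2, glue_lower h3⟩

theorem rank_mul_tail_le {c : ℕ} (hc : 2 * c ≤ n) (x : Skeleton n) :
    rank (x * tail c) ≤ n - 2 * c := by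
  rw [← rank_flip, ← card_lt_subtype (n := n) (m := n - 2 * c) (by omega)]
  refine Nat.card_le_card_of_injective (Subtype.map id ?_)
    (Subtype.map_injective _ Function.injective_id)
  rintro i ⟨j, hij⟩
  by_contra hlt
  simp only [id_eq] at hlt
  obtain ⟨k, h1, -, h3⟩ := mul_tail_inr_inr hc x i (by omega)
  exact absurd ((x * tail c).partner_unique hij h3 (by simp) (by simpa using h1)) (by simp)

theorem rank_tail {c : ℕ} (hc : 2 * c ≤ n) : rank (tail c : Skeleton n) = n - 2 * c := by
  refine le_antisymm (by simpa using rank_mul_tail_le hc (1 : Skeleton n)) ?_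
  rw [← card_lt_subtype (n := n) (m := n - 2 * c) (by omega)]
  refine Nat.card_le_card_of_injective (Subtype.map id ?_)
    (Subtype.map_injective _ Function.injective_id)
  intro i hi
  exact ⟨i, tail_inl_inr i (by omega)⟩

/-- Two connected bottom points enclose two adjacent connected bottom points. -/
theorem exists_adjacent_cup (x : Skeleton n) (p q : Fin n) (hpq : p < q)
    (h : x.1 (Sum.inr p) (Sum.inr q)) :
    ∃ (j : ℕ) (hj : j + 1 < n), j + 1 ≤ q ∧
      x.1 (Sum.inr ⟨j, by omega⟩) (Sum.inr ⟨j + 1, hj⟩) := by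
  induction hd : (q : ℕ) - p using Nat.strong_induction_on generalizing p q with
  | _ d ih =>
    by_cases hadj : (q : ℕ) = p + 1
    · refine ⟨p, by omega, by omega, ?_⟩
      convert h
      exact hadj.symm
    · have hp1 : (p : ℕ) + 1 < n := by omega
      -- By planarity the partner of `p + 1` is trapped strictly between `p` and `q`, which gives a
      -- shorter pair for the induction.
      obtain ⟨t, ht, hxt⟩ := x.exists_partner (Sum.inr ⟨p + 1, hp1⟩)
      have htp : t ≠ Sum.inr p := by
        rintro rfl
        have := x.partner_unique (x.1.symm' hxt) h ht.symm (by simpa using hpq.ne')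
        simp [Fin.ext_iff] at this
        omega
      have htq : t ≠ Sum.inr q := by
        rintro rfl
        have := x.partner_unique (x.1.symm' hxt) (x.1.symm' h) ht.symm (by simpa using hpq.ne)
        simp [Fin.ext_iff] at this
      rcases t with k | k
      · exfalso
        refine x.2.2 (Sum.inl k) (Sum.inr q) (Sum.inr ⟨p + 1, hp1⟩) (Sum.inr p) ?_ ?_ ?_
          ⟨x.1.symm' hxt, x.1.symm' h⟩ <;>
          simp only [bpos, Sum.elim_inl, Sum.elim_inr] <;> omega
      · simp only [ne_eq, Sum.inr.injEq, Fin.ext_iff] at ht htp htq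
        rcases lt_or_ge (k : ℕ) p with hk | hk
        · exfalso
          refine x.2.2 (Sum.inr q) (Sum.inr ⟨p + 1, hp1⟩) (Sum.inr p) (Sum.inr k) ?_ ?_ ?_
            ⟨x.1.symm' h, hxt⟩ <;>
            simp only [bpos, Sum.elim_inr] <;> omega
        · rcases lt_or_ge (q : ℕ) k with hk' | hk'
          · exfalso
            refine x.2.2 (Sum.inr k) (Sum.inr q) (Sum.inr ⟨p + 1, hp1⟩) (Sum.inr p) ?_ ?_ ?_
              ⟨x.1.symm' hxt, x.1.symm' h⟩ <;>
              simp only [bpos, Sum.elim_inr] <;> omega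
          · obtain ⟨j, hj, h1, h2⟩ := ih _ (by simp only; omega) ⟨p + 1, hp1⟩ k
              (by rw [Fin.lt_def]; simp only; omega) hxt rfl
            exact ⟨j, hj, by omega, h2⟩

/-- The last `2 * c` bottom points are matched among themselves by the cups of `tail c`. Either two
of the other `n - 2 * c` bottom points are connected, and then an adjacent pair of them is, or all
of these points lie on through strands. -/
theorem exists_cup_or_rank_eq {c : ℕ} (hc : 2 * c ≤ n) {x : Skeleton n} (hx : x * tail c = x) :
    (∃ j, j + 2 + 2 * c ≤ n ∧ x * cupCap j = x) ∨ rank x = n - 2 * c := by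
  by_cases h : ∃ p q : Fin n, p < q ∧ (q : ℕ) + 2 * c < n ∧ x.1 (Sum.inr p) (Sum.inr q)
  · obtain ⟨p, q, h1, h2, h3⟩ := h
    obtain ⟨j, hj, h4, h5⟩ := exists_adjacent_cup x p q h1 h3
    exact Or.inl ⟨j, by omega, mul_cupCap_of_rel hj h5⟩
  · right
    refine le_antisymm (hx ▸ rank_mul_tail_le hc x) ?_
    rw [← rank_flip, ← card_lt_subtype (n := n) (m := n - 2 * c) (by omega)]
    refine Nat.card_le_card_of_injective (Subtype.map id ?_)
      (Subtype.map_injective _ Function.injective_id)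
    intro i hi
    obtain ⟨t, ht, hit⟩ := x.exists_partner (Sum.inr i)
    rcases t with t | t
    · exact ⟨t, hit⟩
    · exfalso
      have hti : t ≠ i := by simpa using ht
      rcases lt_or_ge ((t : ℕ) + 2 * c) n with hlt | hge
      · rcases lt_or_gt_of_ne hti with h' | h'
        · exact h ⟨t, i, h', by omega, x.1.symm' hit⟩
        · exact h ⟨i, t, h', hlt, hit⟩
      · obtain ⟨k, h1, h2, h3⟩ := mul_tail_inr_inr hc x t hge
        rw [hx] at h3
        have := x.partner_unique h3 (x.1.symm' hit) (by simpa using h1) (by simpa using hti.symm)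
        have : k = i := Sum.inr_injective this
        subst this
        omega

/-- Sandwiching forces all cups and caps of `tail c`. At most one point is left on each side, and
these two can only be joined to each other; so the local monoid at this idempotent is trivial. -/
theorem tail_mul_mul_tail {c : ℕ} (hc : 2 * c ≤ n) (hn : n ≤ 2 * c + 1) (x : Skeleton n) :
    tail c * x * tail c = tail c := by
  set z := tail c * x * tail c with hz
  have htop : ∀ i : Fin n, n ≤ (i : ℕ) + 2 * c → ∃ j : Fin n, j ≠ i ∧ n ≤ (j : ℕ) + 2 * c ∧
      z.1 (Sum.inl i) (Sum.inl j) ∧ (tail c : Skeleton n).1 (Sum.inl i) (Sum.inl j) := by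
    intro i hi
    obtain ⟨j, h1, h2, h3⟩ := tail_inl_inl hc i hi
    exact ⟨j, h1, h2, glue_upper (b := (tail c : Skeleton n).1)
      (p := Sum.inl i) (q := Sum.inl j) (glue_upper h3), h3⟩
  have hbot : ∀ i : Fin n, n ≤ (i : ℕ) + 2 * c → ∃ j : Fin n, j ≠ i ∧ n ≤ (j : ℕ) + 2 * c ∧
      z.1 (Sum.inr i) (Sum.inr j) ∧ (tail c : Skeleton n).1 (Sum.inr i) (Sum.inr j) := by
    intro i hi
    obtain ⟨j, h1, h2, h3⟩ := tail_inr_inr hc i hi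
    exact ⟨j, h1, h2, glue_lower h3, h3⟩
  have hmid : ∀ i : Fin n, (i : ℕ) + 2 * c < n → z.1 (Sum.inl i) (Sum.inr i) := by
    intro i hi
    obtain ⟨t, ht, hit⟩ := z.exists_partner (Sum.inl i)
    rcases t with t | t
    · exfalso
      have hti : t ≠ i := by simpa using ht
      have hti' : (t : ℕ) ≠ i := fun e => hti (Fin.ext e)
      obtain ⟨j, h1, h2, h3, -⟩ := htop t (by omega)
      have := z.partner_unique h3 (z.1.symm' hit) (by simpa using h1) (by simpa using hti.symm)
      have : j = i := Sum.inl_injective this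
      subst this
      omega
    · by_cases e : n ≤ (t : ℕ) + 2 * c
      · obtain ⟨j, h1, h2, h3, -⟩ := hbot t e
        exact absurd (z.partner_unique h3 (z.1.symm' hit) (by simpa using h1) (by simp)) (by simp)
      · rwa [show t = i from Fin.ext (by omega)] at hit
  symm
  refine eq_of_le fun p q hpq => ?_
  have hpart : ∃ r, r ≠ p ∧ z.1 p r ∧ (tail c : Skeleton n).1 p r := by
    rcases p with i | i
    · by_cases hi : n ≤ (i : ℕ) + 2 * c
      · obtain ⟨j, h1, -, h2, h3⟩ := htop i hi
        exact ⟨_, by simpa using h1, h2, h3⟩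
      · exact ⟨_, by simp, hmid i (by omega), tail_inl_inr i (by omega)⟩
    · by_cases hi : n ≤ (i : ℕ) + 2 * c
      · obtain ⟨j, h1, -, h2, h3⟩ := hbot i hi
        exact ⟨_, by simpa using h1, h2, h3⟩
      · exact ⟨Sum.inl i, by simp, z.1.symm' (hmid i (by omega)),
          (tail c : Skeleton n).1.symm' (tail_inl_inr i (by omega))⟩
  obtain ⟨r, h1, h2, h3⟩ := hpart
  by_cases e : q = p
  · rw [e]
  · rwa [(tail c).partner_unique hpq h3 e h1]

/-! ### The ideals generated by the idempotents -/

/-- The two-sided ideal generated by `tail c`. -/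
def tailIdeal (n c : ℕ) : Set (Skeleton n) := {x | ∃ p q, x = p * tail c * q}

theorem tail_mem_tailIdeal (c : ℕ) : tail c ∈ tailIdeal n c := ⟨1, 1, by simp⟩

theorem mul_mem_tailIdeal {c : ℕ} {x : Skeleton n} (y : Skeleton n) (hx : x ∈ tailIdeal n c) :
    x * y ∈ tailIdeal n c := by
  obtain ⟨p, q, rfl⟩ := hx
  exact ⟨p, q * y, by simp only [mul_assoc]⟩

theorem mul_mem_tailIdeal' {c : ℕ} {x : Skeleton n} (y : Skeleton n) (hx : x ∈ tailIdeal n c) :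
    y * x ∈ tailIdeal n c := by
  obtain ⟨p, q, rfl⟩ := hx
  exact ⟨y * p, q, by simp only [mul_assoc]⟩

theorem flip_mem_tailIdeal {c : ℕ} (hc : 2 * c ≤ n) {x : Skeleton n} (hx : x ∈ tailIdeal n c) :
    flip x ∈ tailIdeal n c := by
  obtain ⟨p, q, rfl⟩ := hx
  exact ⟨flip q, flip p, by rw [flip_mul, flip_mul, flip_tail hc, mul_assoc]⟩

theorem rank_le_of_mem_tailIdeal {c : ℕ} (hc : 2 * c ≤ n) {x : Skeleton n}
    (hx : x ∈ tailIdeal n c) : rank x ≤ n - 2 * c := by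
  obtain ⟨p, q, rfl⟩ := hx
  exact (rank_mul_le _ _).trans (rank_mul_tail_le hc p)

theorem tailIdeal_succ_subset (c : ℕ) :
    tailIdeal n (c + 1) ⊆ tailIdeal n c := by
  rintro x ⟨p, q, rfl⟩
  exact ⟨p * cupCap (n - 2 * c - 2), q, by rw [tail_succ]; simp only [mul_assoc]⟩

theorem tailIdeal_antitone : Antitone (tailIdeal n) :=
  antitone_nat_of_succ_le tailIdeal_succ_subset

/-- A cup can be moved to the right by multiplications that can be undone. -/
theorem exists_move_cup {c j : ℕ} (hj : j + 2 + 2 * c ≤ n) {x : Skeleton n} (hx : x * tail c = x)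
    (hxj : x * cupCap j = x) :
    ∃ q q' : Skeleton n, x * q * tail (c + 1) = x * q ∧ x * q * q' = x := by
  induction hd : n - 2 * c - 2 - j generalizing j x with
  | zero =>
    obtain rfl : j = n - 2 * c - 2 := by omega
    refine ⟨1, 1, ?_, by simp⟩
    rw [mul_one, tail_succ, ← mul_assoc, hxj, hx]
  | succ d ih =>
    -- Multiplying by the generator at `j + 1` shifts the cup one step right; the generator at `j`
    -- shifts it back, by `u_j u_{j+1} u_j = u_j` and because `x` absorbs `u_j`.
    obtain ⟨q, q', h1, h2⟩ := ih (j := j + 1) (x := x * cupCap (j + 1)) (by omega)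
      (by rw [mul_assoc, cupCap_mul_tail (by omega), ← mul_assoc, hx])
      (by rw [mul_assoc, cupCap_mul_self (by omega)]) (by omega)
    refine ⟨cupCap (j + 1) * q, q' * cupCap j, by rw [← mul_assoc, h1], ?_⟩
    rw [← mul_assoc, ← mul_assoc, h2]
    calc x * cupCap (j + 1) * cupCap j = x * cupCap j * cupCap (j + 1) * cupCap j := by rw [hxj]
      _ = x * (cupCap j * cupCap (j + 1) * cupCap j) := by simp only [mul_assoc]
      _ = x := by rw [cupCap_braid_of_adjacent (by omega) (by omega) (Or.inr rfl), hxj]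

/-- Cups are collected at the right end one at a time until every remaining bottom point lies on a
through strand. Each move can be undone by a right multiplication, so it changes neither the rank
nor the two-sided ideal generated. Hence rank alone decides membership in the ideals. -/
theorem exists_rank_eq_and_mem_tailIdeal (x : Skeleton n) :
    ∃ c, 2 * c ≤ n ∧ rank x = n - 2 * c ∧ x ∈ tailIdeal n c := by
  suffices h : ∀ (d c : ℕ) (x : Skeleton n), n - 2 * c ≤ d → 2 * c ≤ n → x * tail c = x →
      ∃ c, 2 * c ≤ n ∧ rank x = n - 2 * c ∧ x ∈ tailIdeal n c from
    h n 0 x (by omega) (by omega) (by rw [tail, mul_one])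
  intro d
  induction d with
  | zero =>
    intro c x h1 h2 h3
    rcases exists_cup_or_rank_eq h2 h3 with ⟨j, hj, -⟩ | h
    · omega
    · exact ⟨c, h2, h, x, 1, by rw [h3, mul_one]⟩
  | succ d ih =>
    intro c x h1 h2 h3
    rcases exists_cup_or_rank_eq h2 h3 with ⟨j, hj, hxj⟩ | h
    · obtain ⟨q, q', h4, h5⟩ := exists_move_cup hj h3 hxj
      obtain ⟨c', h6, h7, h8⟩ := ih (c + 1) (x * q) (by omega) (by omega) h4
      refine ⟨c', h6, ?_, ?_⟩
      · rw [← h7]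
        refine le_antisymm ?_ (rank_mul_le x q)
        conv_lhs => rw [← h5]
        exact rank_mul_le _ _
      · rw [← h5]
        exact mul_mem_tailIdeal _ h8
    · exact ⟨c, h2, h, x, 1, by rw [h3, mul_one]⟩

theorem mem_tailIdeal_one_of_ne_one {x : Skeleton n} (hx : x ≠ 1) : 2 ≤ n ∧ x ∈ tailIdeal n 1 := by
  rcases exists_cup_or_rank_eq (c := 0) (by omega) (x := x) (by rw [tail, mul_one]) with
    ⟨j, hj, hxj⟩ | h
  · obtain ⟨q, q', h1, h2⟩ := exists_move_cup (c := 0) (by omega) (x := x)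
      (by rw [tail, mul_one]) hxj
    exact ⟨by omega, x * q, q', by rw [h1, h2]⟩
  · exact absurd (eq_one_of_rank (by simpa using h)) hx

theorem cupCap_mul_tail_mem {c j : ℕ} (hj : j + 2 + 2 * c ≤ n) :
    (cupCap j : Skeleton n) * tail c ∈ tailIdeal n (c + 1) := by
  obtain ⟨q, q', h1, h2⟩ := exists_move_cup hj (x := (cupCap j : Skeleton n) * tail c)
    (by rw [mul_assoc, tail_mul_self (by omega)])
    (by rw [mul_assoc, ← cupCap_mul_tail hj, ← mul_assoc, cupCap_mul_self (by omega)])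
  exact ⟨_, q', by rw [h1, h2]⟩

/-! ### Connectedness of the ideals -/

/-- The equivalence relation on the ideal of `tail c` generated by `b * a ≈ a`. -/
def LeftRel (n c : ℕ) : Skeleton n → Skeleton n → Prop :=
  Relation.EqvGen fun s a => ∃ b ∈ tailIdeal n c, a ∈ tailIdeal n c ∧ s = b * a

theorem leftRel_mul {c : ℕ} {a b : Skeleton n} (hb : b ∈ tailIdeal n c) (ha : a ∈ tailIdeal n c) :
    LeftRel n c (b * a) a := Relation.EqvGen.rel _ _ ⟨b, hb, ha, rfl⟩

/-- If `i` and `j` are at least two apart, left multiplication of `u_i * tail c * q` by `u_j * tail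
c`, and of `u_j * tail c * q` by `u_i * tail c`, give the same diagram. Near positions are compared
through a third one. -/
theorem leftRel_cupCap {c i j : ℕ} (hi : i + 2 + 2 * c ≤ n) (hj : j + 2 + 2 * c ≤ n)
    (hn : 5 + 2 * c ≤ n) (q : Skeleton n) :
    LeftRel n (c + 1) (cupCap i * tail c * q) (cupCap j * tail c * q) := by
  have far : ∀ {i j : ℕ}, i + 2 ≤ j → j + 2 + 2 * c ≤ n →
      LeftRel n (c + 1) (cupCap i * tail c * q) (cupCap j * tail c * q) := by
    intro i j hij hj
    have hmem : ∀ {t}, t + 2 + 2 * c ≤ n → cupCap t * tail c * q ∈ tailIdeal n (c + 1) :=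
      fun ht => mul_mem_tailIdeal q (cupCap_mul_tail_mem ht)
    have h1 := leftRel_mul (cupCap_mul_tail_mem hj) (hmem (t := i) (by omega))
    have h2 := leftRel_mul (cupCap_mul_tail_mem (j := i) (by omega)) (hmem hj)
    have e : ∀ {s t}, s + 2 + 2 * c ≤ n → t + 2 + 2 * c ≤ n →
        (cupCap s : Skeleton n) * tail c * (cupCap t * tail c * q) =
          cupCap s * cupCap t * tail c * q := by
      intro s t hs ht
      calc (cupCap s : Skeleton n) * tail c * (cupCap t * tail c * q) =
          cupCap s * (tail c * cupCap t) * tail c * q := by simp only [mul_assoc]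
        _ = cupCap s * cupCap t * (tail c * tail c) * q := by
          rw [← cupCap_mul_tail ht]; simp only [mul_assoc]
        _ = _ := by rw [tail_mul_self (by omega)]
    rw [e hj (by omega)] at h1
    rw [e (by omega) hj, cupCap_comm hij (by omega)] at h2
    exact h1.symm.trans _ _ _ h2
  -- Here `5 + 2 * c ≤ n` enters: position `3` is available, and it is far from both `0` and `1`.
  have zero : ∀ {i}, i + 2 + 2 * c ≤ n → LeftRel n (c + 1) (cupCap i * tail c * q)
      (cupCap 0 * tail c * q) := by
    intro i hi
    rcases Nat.lt_or_ge 1 i with h | h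
    · exact (far (by omega) hi).symm
    · rcases Nat.eq_zero_or_pos i with rfl | h'
      · exact Relation.EqvGen.refl _
      · obtain rfl : i = 1 := by omega
        exact (far (j := 3) (by omega) (by omega)).trans _ _ _
          (far (i := 0) (j := 3) (by omega) (by omega)).symm
  exact (zero hi).trans _ _ _ (zero hj).symm

/-- With `x = p * tail c * q`, the diagram `z * p * tail c` has too few through strands, hence an
extra cup at some `j`. So `z * x` is a left multiple of `u_j * tail c * q`, whose class depends
neither on `j` nor on `z`. -/
theorem leftRel_mul_of_mem {c : ℕ} (hn : 5 + 2 * c ≤ n) {z w x : Skeleton n}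
    (hz : z ∈ tailIdeal n (c + 1)) (hw : w ∈ tailIdeal n (c + 1)) (hx : x ∈ tailIdeal n c) :
    LeftRel n (c + 1) (z * x) (w * x) := by
  obtain ⟨p, q, rfl⟩ := hx
  have key : ∀ z ∈ tailIdeal n (c + 1),
      LeftRel n (c + 1) (z * (p * tail c * q)) (cupCap 0 * tail c * q) := by
    intro z hz
    have hzp : z * p * tail c ∈ tailIdeal n (c + 1) :=
      mul_mem_tailIdeal _ (mul_mem_tailIdeal _ hz)
    obtain ⟨j, hj, h⟩ | h := exists_cup_or_rank_eq (c := c) (by omega) (x := z * p * tail c)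
      (by rw [mul_assoc, tail_mul_self (by omega)])
    · have e : z * (p * tail c * q) = z * p * (cupCap j * tail c * q) := by
        calc z * (p * tail c * q) = z * p * tail c * q := by simp only [mul_assoc]
          _ = z * p * tail c * cupCap j * q := by rw [h]
          _ = z * p * (tail c * cupCap j) * q := by simp only [mul_assoc]
          _ = _ := by rw [← cupCap_mul_tail hj]; simp only [mul_assoc]
      rw [e]
      exact (leftRel_mul (mul_mem_tailIdeal _ hz)
        (mul_mem_tailIdeal q (cupCap_mul_tail_mem hj))).trans _ _ _
          (leftRel_cupCap hj (by omega) hn q)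
    -- Full rank `n - 2 * c` is impossible in the ideal of `tail (c + 1)`.
    · have := rank_le_of_mem_tailIdeal (by omega) hzp
      omega
  exact (key z hz).trans _ _ _ (key w hw).symm

/-- A chain joining `x` to `y` in the larger ideal of `tail c` is multiplied on the left by `tail (c
+ 1)`; each of its links becomes an instance of `leftRel_mul_of_mem`. -/
theorem leftRel_of_mem {c : ℕ} (hn : 3 + 2 * c ≤ n) {x y : Skeleton n} (hx : x ∈ tailIdeal n c)
    (hy : y ∈ tailIdeal n c) : LeftRel n c x y := by
  induction c generalizing x y with
  | zero =>
    have h1 : (1 : Skeleton n) ∈ tailIdeal n 0 := tail_mem_tailIdeal 0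
    have := leftRel_mul hx h1
    have h2 := leftRel_mul hy h1
    rw [mul_one] at this h2
    exact this.trans _ _ _ h2.symm
  | succ c ih =>
    have hsub := tailIdeal_succ_subset (n := n) c
    have ht := tail_mem_tailIdeal (n := n) (c + 1)
    have key : ∀ x y, LeftRel n c x y → LeftRel n (c + 1) (tail (c + 1) * x) (tail (c + 1) * y) := by
      intro x y h
      induction h with
      | rel s a h =>
        obtain ⟨b, hb, ha, rfl⟩ := h
        rw [← mul_assoc]
        exact leftRel_mul_of_mem (by omega) (mul_mem_tailIdeal _ ht) ht ha
      | refl => exact Relation.EqvGen.refl _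
      | symm _ _ _ ih => exact ih.symm
      | trans _ _ _ _ _ ih1 ih2 => exact ih1.trans _ _ _ ih2
    have h1 := leftRel_mul ht hx
    have h2 := leftRel_mul ht hy
    exact h1.symm.trans _ _ _ ((key x y (ih (by omega) (hsub hx) (hsub hy))).trans
      _ _ _ h2)

/-- The equivalence relation on the ideal of `tail c` generated by `a * b ≈ a`. -/
def RightRel (n c : ℕ) : Skeleton n → Skeleton n → Prop :=
  Relation.EqvGen fun s a => ∃ b ∈ tailIdeal n c, a ∈ tailIdeal n c ∧ s = a * b

theorem rightRel_of_mem {c : ℕ} (hn : 3 + 2 * c ≤ n) {x y : Skeleton n} (hx : x ∈ tailIdeal n c)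
    (hy : y ∈ tailIdeal n c) : RightRel n c x y := by
  have hc : 2 * c ≤ n := by omega
  have key : ∀ x y, LeftRel n c x y → RightRel n c (flip x) (flip y) := by
    intro x y h
    induction h with
    | rel s a h =>
      obtain ⟨b, hb, ha, rfl⟩ := h
      exact Relation.EqvGen.rel _ _
        ⟨flip b, flip_mem_tailIdeal hc hb, flip_mem_tailIdeal hc ha, flip_mul b a⟩
    | refl => exact Relation.EqvGen.refl _
    | symm _ _ _ ih => exact ih.symm
    | trans _ _ _ _ _ ih1 ih2 => exact ih1.trans _ _ _ ih2
  have := key _ _ (leftRel_of_mem hn (flip_mem_tailIdeal hc hx) (flip_mem_tailIdeal hc hy))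
  rwa [flip_flip, flip_flip] at this

end Skeleton

namespace TruncatedTL

open Skeleton

variable {m n : ℕ}

/-! ### Diagrams with loops and their skeletons -/

/-- The skeleton of a diagram. -/
def skeleton : cyclicTL m n →* Skeleton n where
  toFun x := ⟨x.1.skel, x.2⟩
  map_one' := rfl
  map_mul' _ _ := rfl

theorem skeleton_surjective : Function.Surjective (skeleton : cyclicTL m n →* Skeleton n) :=
  fun a => ⟨⟨⟨a.1, 0⟩, a.2⟩, rfl⟩

theorem ext_skeleton {x y : cyclicTL m n} (h : skeleton x = skeleton y)
    (h' : x.1.loops = y.1.loops) : x = y :=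
  Subtype.ext (LoopDiagram.ext (congrArg Subtype.val h) h')

theorem loops_mul (x y : cyclicTL m n) : (x * y).1.loops =
    x.1.loops + y.1.loops + (stackLoops (skeleton x).1 (skeleton y).1 : ZMod m) := rfl

/-- Loop numbers form a group, so that of the missing factor can be solved for. Factorisations of
skeletons therefore lift to diagrams. -/
theorem exists_eq_mul_right {x y : cyclicTL m n} {a : Skeleton n}
    (h : skeleton x = a * skeleton y) : ∃ z, skeleton z = a ∧ x = z * y := by
  refine ⟨⟨⟨a.1, x.1.loops - y.1.loops - (stackLoops a.1 (skeleton y).1 : ZMod m)⟩, a.2⟩, rfl,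
    ext_skeleton h ?_⟩
  rw [loops_mul]
  change _ = (x.1.loops - y.1.loops - (stackLoops a.1 (skeleton y).1 : ZMod m)) + y.1.loops +
    (stackLoops a.1 (skeleton y).1 : ZMod m)
  ring

theorem exists_eq_mul_left {x y : cyclicTL m n} {a : Skeleton n}
    (h : skeleton x = skeleton y * a) : ∃ z, skeleton z = a ∧ x = y * z := by
  refine ⟨⟨⟨a.1, x.1.loops - y.1.loops - (stackLoops (skeleton y).1 a.1 : ZMod m)⟩, a.2⟩, rfl,
    ext_skeleton h ?_⟩
  rw [loops_mul]
  change _ = y.1.loops + (x.1.loops - y.1.loops - (stackLoops (skeleton y).1 a.1 : ZMod m)) +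
    (stackLoops (skeleton y).1 a.1 : ZMod m)
  ring

theorem pow_of_idempotent {x : cyclicTL m n} (h : skeleton x * skeleton x = skeleton x) (t : ℕ) :
    skeleton (x ^ (t + 1)) = skeleton x ∧ (x ^ (t + 1)).1.loops =
      (t + 1 : ZMod m) * x.1.loops +
        t * (stackLoops (skeleton x).1 (skeleton x).1 : ZMod m) := by
  induction t with
  | zero => simp
  | succ t ih =>
    rw [pow_succ, map_mul, ih.1, h, loops_mul, ih.1, ih.2]
    refine ⟨rfl, ?_⟩
    push_cast
    ring

/-- The power has `(m + 1) * i + m * Φ` loops, where `i` is the loop number of `x` and `Φ` that of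
its stack with itself; modulo `m` this is `i`. -/
theorem pow_add_one_of_idempotent {x : cyclicTL m n} (h : skeleton x * skeleton x = skeleton x) :
    x ^ (m + 1) = x := by
  obtain ⟨h1, h2⟩ := pow_of_idempotent h m
  refine ext_skeleton h1 ?_
  rw [h2]
  simp

theorem pow_eq_one {x : cyclicTL m n} (h : skeleton x = 1) : x ^ m = 1 := by
  obtain ⟨z, -, hz⟩ := exists_eq_mul_left (x := 1) (y := x) (a := 1) (by rw [h, map_one, mul_one])
  have h1 := pow_add_one_of_idempotent (x := x) (by rw [h, mul_one])
  calc x ^ m = x ^ m * (x * z) := by rw [← hz, mul_one]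
    _ = x ^ (m + 1) * z := by rw [pow_succ, mul_assoc]
    _ = 1 := by rw [h1, ← hz]

/-! ### Cells -/

theorem mem_cellsAbove_throughCell {c : ℕ} (hc : 2 * c ≤ n) {x : cyclicTL m n} :
    x ∈ cellsAbove (throughCell m n (n - 2 * c)) ↔ skeleton x ∈ tailIdeal n c := by
  constructor
  · rintro ⟨a, ha, y, z, rfl⟩
    obtain ⟨c', h1, h2, h3⟩ := exists_rank_eq_and_mem_tailIdeal (skeleton a)
    have ha : rank (skeleton a) = n - 2 * c := ha
    obtain rfl : c' = c := by omega
    rw [map_mul, map_mul]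
    exact mul_mem_tailIdeal _ (mul_mem_tailIdeal' _ h3)
  · rintro ⟨p, q, h⟩
    obtain ⟨t, ht⟩ := skeleton_surjective (m := m) (tail c : Skeleton n)
    obtain ⟨q', hq⟩ := skeleton_surjective (m := m) q
    rw [mul_assoc, ← ht, ← hq, ← map_mul] at h
    obtain ⟨p', -, rfl⟩ := exists_eq_mul_right h
    refine ⟨t, ?_, p', q', by rw [mul_assoc]⟩
    change rank (skeleton t) = _
    rw [ht, rank_tail hc]

theorem rank_of_mem_cellsAbove {k : ℕ} {x : cyclicTL m n}
    (hx : x ∈ cellsAbove {x : cyclicTL m n | throughStrands x + 2 = k}) :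
    rank (skeleton x) + 2 ≤ k := by
  obtain ⟨a, ha, y, z, rfl⟩ := hx
  obtain ⟨c, h1, h2, h3⟩ := exists_rank_eq_and_mem_tailIdeal (skeleton a)
  have ha : rank (skeleton a) + 2 = k := ha
  have : skeleton (y * a * z) ∈ tailIdeal n c := by
    rw [map_mul, map_mul]
    exact mul_mem_tailIdeal _ (mul_mem_tailIdeal' _ h3)
  have := rank_le_of_mem_tailIdeal h1 this
  omega

theorem rank_one : rank (1 : Skeleton n) = n := by
  simpa [tail] using rank_tail (n := n) (c := 0) (by omega)

theorem eq_one_of_mul_eq_one {x y : Skeleton n} (h : x * y = 1) : x = 1 := by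
  by_contra hx
  obtain ⟨h1, h2⟩ := mem_tailIdeal_one_of_ne_one hx
  have h3 := rank_le_of_mem_tailIdeal (by omega) (mul_mem_tailIdeal y h2)
  rw [h, rank_one] at h3
  omega

/-! ### The truncated monoid -/

variable {k l : ℕ}

/-- The class of a diagram in the truncated monoid. -/
noncomputable abbrev proj (k : ℕ) : cellSubmonoid (throughCell m n l) →* TruncatedTL m n k l :=
  (cellCon (throughCell m n l) {x : cyclicTL m n | throughStrands x + 2 = k}).mk'

theorem proj_surjective (x : TruncatedTL m n k l) : ∃ y, proj k y = x := Con.mk'_surjective x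

theorem proj_eq_proj {x y : cellSubmonoid (throughCell m n l)} :
    proj k x = proj k y ↔ x = y ∨
      ((x : cyclicTL m n) ∈ cellsAbove {x : cyclicTL m n | throughStrands x + 2 = k} ∧
      (y : cyclicTL m n) ∈ cellsAbove {x : cyclicTL m n | throughStrands x + 2 = k}) :=
  Con.eq _

theorem proj_pow_eq_one {x : cellSubmonoid (throughCell m n l)} (h : skeleton x.1 = 1) :
    proj k x ^ m = 1 := by
  rw [← map_pow]
  have : x ^ m = 1 := Subtype.ext (by simpa using pow_eq_one h)
  rw [this, map_one]

theorem isUnit_proj [NeZero m] (hkn : k ≤ n) {x : cellSubmonoid (throughCell m n l)} :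
    IsUnit (proj k x) ↔ skeleton x.1 = 1 := by
  constructor
  · intro h
    obtain ⟨s, hs⟩ := h.exists_right_inv
    obtain ⟨y, rfl⟩ := proj_surjective s
    rw [← map_mul, ← map_one (proj k), proj_eq_proj] at hs
    rcases hs with hs | ⟨-, hs⟩
    · have h1 : (x.1 * y.1 : cyclicTL m n) = 1 := congrArg Subtype.val hs
      have h2 := congrArg skeleton h1
      rw [map_mul, map_one] at h2
      exact eq_one_of_mul_eq_one h2
    -- The identity is not among the diagrams collapsed to zero: it has `n ≥ k` through strands, and
    -- those have at most `k - 2`.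
    · have := rank_of_mem_cellsAbove hs
      rw [OneMemClass.coe_one, map_one, rank_one] at this
      omega
  · intro h
    exact IsUnit.of_pow_eq_one (proj_pow_eq_one h) (NeZero.ne m)

/-- The non-invertible elements of the truncated monoid are the classes of the diagrams in
`tailIdeal n c`, and it has a diagram `tail d` in its lowest cell. -/
structure IsTruncation (m n k l c d : ℕ) : Prop where
  c_pos : 1 ≤ c
  c_lt_d : c < d
  two_mul_d_le : 2 * d ≤ n
  k_le : k ≤ n - 2 * c
  k_eq : n - 2 * d + 2 = k ∨ (k ≤ 1 ∧ n - 2 * d = k ∧ 3 + 2 * c ≤ n)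
  mem_of_skeleton : ∀ x : cyclicTL m n, skeleton x ∈ tailIdeal n c →
    x ∈ cellsAbove (throughCell m n l)
  skeleton_mem : ∀ x ∈ cellSubmonoid (throughCell m n l), skeleton x ≠ 1 →
    skeleton x ∈ tailIdeal n c

/-- For `l < n` the non-units are the diagrams with at most `l` through strands, so `c = (n - l) /
2`. For `l = n` the diagrams with `n` through strands are units, so `c = 1`. The idempotent `tail d`
has `k` through strands if `k ≤ 1`, and `k - 2` otherwise, so that it then represents the zero. -/
theorem exists_isTruncation (hk : k ≡ n [MOD 2]) (hl : l ≡ n [MOD 2]) (hkl : k < l) (hln : l ≤ n)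
    (hl3 : 3 ≤ l) (hedge : l = n → 2 ≤ k ∨ 5 ≤ n) : ∃ c d, IsTruncation m n k l c d := by
  unfold Nat.ModEq at hk hl
  obtain ⟨d, hd, hkd⟩ : ∃ d, 2 * d ≤ n ∧ (n - 2 * d + 2 = k ∨ (k ≤ 1 ∧ n - 2 * d = k)) := by
    rcases Nat.lt_or_ge k 2 with h | h
    · exact ⟨(n - k) / 2, by omega, by omega⟩
    · exact ⟨(n - k + 2) / 2, by omega, by omega⟩
  rcases hln.lt_or_eq with hlt | rfl
  · obtain ⟨c, hc, rfl⟩ : ∃ c, 2 * c ≤ n ∧ l = n - 2 * c := ⟨(n - l) / 2, by omega, by omega⟩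
    refine ⟨c, d, by omega, by omega, hd, by omega, by omega,
      fun x => (mem_cellsAbove_throughCell hc).2, ?_⟩
    rintro x (hx | hx) h
    · exact (mem_cellsAbove_throughCell hc).1 hx
    · rw [Set.mem_singleton_iff.1 hx, map_one] at h
      exact absurd rfl h
  · refine ⟨1, d, by omega, by omega, hd, by omega, by omega, fun x hx => ?_,
      fun x _ h => (mem_tailIdeal_one_of_ne_one h).2⟩
    exact (mem_cellsAbove_throughCell (c := 0) (by omega)).2 (tailIdeal_antitone (by omega) hx)

/-! ### Connectedness and additive characters of the truncated monoid -/

namespace IsTruncation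

variable {c d : ℕ}

theorem ne_one (h : IsTruncation m n k l c d) {a : Skeleton n} (ha : a ∈ tailIdeal n c) :
    a ≠ 1 := by
  rintro rfl
  have h1 := h.c_pos
  have h2 := h.c_lt_d
  have h3 := h.two_mul_d_le
  have h4 := rank_le_of_mem_tailIdeal (by omega) ha
  rw [rank_one] at h4
  omega

theorem two_mul_c_le (h : IsTruncation m n k l c d) : 2 * c ≤ n := by
  have h2 := h.c_lt_d
  have h3 := h.two_mul_d_le
  omega

theorem k_le_n (h : IsTruncation m n k l c d) : k ≤ n := h.k_le.trans (Nat.sub_le _ _)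

theorem tail_mem (h : IsTruncation m n k l c d) : tail d ∈ tailIdeal n c :=
  tailIdeal_antitone h.c_lt_d.le (tail_mem_tailIdeal d)

/-- The class of a diagram in the ideal of `tail c`. -/
noncomputable def cls (h : IsTruncation m n k l c d) (x : cyclicTL m n)
    (hx : skeleton x ∈ tailIdeal n c) : TruncatedTL m n k l :=
  proj k ⟨x, Or.inl (h.mem_of_skeleton x hx)⟩

theorem not_isUnit_cls [NeZero m] (h : IsTruncation m n k l c d) {x : cyclicTL m n}
    (hx : skeleton x ∈ tailIdeal n c) : ¬ IsUnit (h.cls x hx) := by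
  rw [cls, isUnit_proj h.k_le_n]
  exact h.ne_one hx

theorem exists_eq_cls [NeZero m] (h : IsTruncation m n k l c d) {s : TruncatedTL m n k l}
    (hs : ¬ IsUnit s) : ∃ x hx, s = h.cls x hx := by
  obtain ⟨x, rfl⟩ := proj_surjective s
  rw [isUnit_proj h.k_le_n] at hs
  exact ⟨x.1, h.skeleton_mem x.1 x.2 hs, rfl⟩

theorem pow_eq_one_of_isUnit [NeZero m] (h : IsTruncation m n k l c d) {s : TruncatedTL m n k l}
    (hs : IsUnit s) : s ^ m = 1 := by
  obtain ⟨x, rfl⟩ := proj_surjective s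
  exact proj_pow_eq_one ((isUnit_proj h.k_le_n).1 hs)

/-- Two distinct non-units rule out the two conventional exceptions and force a nontrivial simple
representation. -/
theorem exists_ne [NeZero m] (h : IsTruncation m n k l c d) :
    ∃ s t : TruncatedTL m n k l, ¬ IsUnit s ∧ ¬ IsUnit t ∧ s ≠ t := by
  obtain ⟨x, hx⟩ := skeleton_surjective (m := m) (tail c : Skeleton n)
  obtain ⟨y, hy⟩ := skeleton_surjective (m := m) (tail d : Skeleton n)
  have hx' : skeleton x ∈ tailIdeal n c := hx ▸ tail_mem_tailIdeal c
  have hy' : skeleton y ∈ tailIdeal n c := hy ▸ h.tail_mem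
  refine ⟨h.cls x hx', h.cls y hy', h.not_isUnit_cls _, h.not_isUnit_cls _, fun e => ?_⟩
  have h1 := rank_tail (n := n) h.two_mul_c_le
  have h2 := rank_tail (n := n) h.two_mul_d_le
  rw [← hx] at h1
  rw [← hy] at h2
  have h3 := h.c_lt_d
  have h4 := h.two_mul_d_le
  have h5 := h.k_le
  rcases proj_eq_proj.1 e with e | ⟨e, -⟩
  · have : x = y := congrArg Subtype.val e
    rw [this] at h1
    omega
  · have := rank_of_mem_cellsAbove e
    simp only at this
    omega

/-- On skeletons, `p * tail c * q = (p * tail c) * (tail c * q)` by idempotency. -/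
theorem isNullConnected [NeZero m] (h : IsTruncation m n k l c d) :
    IsNullConnected (TruncatedTL m n k l) := by
  intro s hs
  obtain ⟨x, hx, rfl⟩ := h.exists_eq_cls hs
  have hx' := hx
  obtain ⟨p, q, hpq⟩ := hx
  obtain ⟨y, hy⟩ := skeleton_surjective (m := m) (tail c * q : Skeleton n)
  obtain ⟨z, hz, rfl⟩ := exists_eq_mul_right (x := x) (y := y) (a := p * tail c) (by
    rw [hpq, hy, mul_assoc p (tail c) (tail c * q), ← mul_assoc (tail c) (tail c) q, tail_mul_self h.two_mul_c_le, mul_assoc])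
  have hz' : skeleton z ∈ tailIdeal n c := hz ▸ mul_mem_tailIdeal' p (tail_mem_tailIdeal c)
  have hy' : skeleton y ∈ tailIdeal n c := hy ▸ mul_mem_tailIdeal q (tail_mem_tailIdeal c)
  exact ⟨h.cls z hz', h.cls y hy', h.not_isUnit_cls _, h.not_isUnit_cls _, rfl⟩

/-- If diagrams with few through strands are identified, they form a zero element. -/
theorem exists_zero [NeZero m] (h : IsTruncation m n k l c d) (hd : n - 2 * d + 2 = k) :
    ∃ z : TruncatedTL m n k l, ¬ IsUnit z ∧ ∀ s, z * s = z ∧ s * z = z := by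
  obtain ⟨y, hy⟩ := skeleton_surjective (m := m) (tail d : Skeleton n)
  have hy' : skeleton y ∈ tailIdeal n c := hy ▸ h.tail_mem
  have hmem : y ∈ cellsAbove {x : cyclicTL m n | throughStrands x + 2 = k} := by
    refine ⟨y, ?_, 1, 1, by simp⟩
    change rank (skeleton y) + 2 = k
    rw [hy, rank_tail h.two_mul_d_le, hd]
  refine ⟨h.cls y hy', h.not_isUnit_cls _, fun s => ?_⟩
  obtain ⟨x, rfl⟩ := proj_surjective s
  rw [cls, ← map_mul, ← map_mul, proj_eq_proj, proj_eq_proj]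
  exact ⟨Or.inr ⟨cellsAbove_mul_right _ hmem, hmem⟩, Or.inr ⟨cellsAbove_mul_left _ hmem, hmem⟩⟩

/-- A chain of skeletons lifts to diagrams only up to loop numbers. The prefix `t` over the
idempotent `tail c` lets left multiplication within the ideal correct them. -/
theorem eqvGen_of_leftRel [NeZero m] (h : IsTruncation m n k l c d) {a b : Skeleton n}
    (hab : LeftRel n c a b) {t x y : cyclicTL m n} (ht : skeleton t = tail c)
    (hx : skeleton x = a) (hy : skeleton y = b) (htx : skeleton (t * x) ∈ tailIdeal n c)
    (hty : skeleton (t * y) ∈ tailIdeal n c) :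
    Relation.EqvGen (fun s a : TruncatedTL m n k l => ∃ b, ¬ IsUnit a ∧ ¬ IsUnit b ∧ s = b * a)
      (h.cls (t * x) htx) (h.cls (t * y) hty) := by
  have ht' : skeleton t ∈ tailIdeal n c := ht ▸ tail_mem_tailIdeal c
  have step : ∀ {z y : cyclicTL m n} (hz : skeleton z ∈ tailIdeal n c)
      (hy : skeleton y ∈ tailIdeal n c) (hzy : skeleton (z * y) ∈ tailIdeal n c),
      Relation.EqvGen (fun s a : TruncatedTL m n k l => ∃ b, ¬ IsUnit a ∧ ¬ IsUnit b ∧ s = b * a)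
        (h.cls (z * y) hzy) (h.cls y hy) := fun hz hy _ =>
    Relation.EqvGen.rel _ _ ⟨h.cls _ hz, h.not_isUnit_cls _, h.not_isUnit_cls _, rfl⟩
  induction hab generalizing x y with
  | rel s a hsa =>
    obtain ⟨b, hb, ha, rfl⟩ := hsa
    rw [← hy] at hx ha
    obtain ⟨z, hz, rfl⟩ := exists_eq_mul_right hx
    have hb' : skeleton (t * z) ∈ tailIdeal n c := by
      rw [map_mul, hz]; exact mul_mem_tailIdeal' _ hb
    have h1 := step hb' ha (by rw [mul_assoc]; exact htx)
    simp only [mul_assoc] at h1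
    exact h1.trans _ _ _ (step ht' ha hty).symm
  | refl a =>
    -- Equal skeletons may still carry different loop numbers; a factor `z` over `tail c` supplies
    -- the difference.
    obtain ⟨z, hz, e⟩ := exists_eq_mul_right (x := t * x) (y := t * y) (a := tail c) (by
      rw [map_mul, map_mul, ht, hx, hy, ← mul_assoc, tail_mul_self h.two_mul_c_le])
    have h1 := step (hz ▸ tail_mem_tailIdeal c) hty (e ▸ htx)
    simp only [← e] at h1
    exact h1
  | symm _ _ _ ih => exact (ih hy hx hty htx).symm
  | trans a b d _ _ ih1 ih2 =>
    obtain ⟨w, hw⟩ := skeleton_surjective (m := m) b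
    have htw : skeleton (t * w) ∈ tailIdeal n c := by
      rw [map_mul]; exact mul_mem_tailIdeal _ ht'
    exact (ih1 hx hw htx htw).trans _ _ _ (ih2 hw hy htw hty)

theorem isLeftConnected [NeZero m] (h : IsTruncation m n k l c d) :
    IsLeftConnected (TruncatedTL m n k l) := by
  refine ⟨let ⟨s, _, hs, _⟩ := h.exists_ne; ⟨s, hs⟩, fun s s' hs hs' => ?_⟩
  rcases h.k_eq with hd | ⟨-, -, hc⟩
  · obtain ⟨z, hz, hz'⟩ := h.exists_zero hd
    exact (Relation.EqvGen.rel _ _ ⟨z, hs, hz, (hz' s).1.symm⟩).symm.trans _ _ _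
      (Relation.EqvGen.rel _ _ ⟨z, hs', hz, (hz' s').1.symm⟩)
  · obtain ⟨x, hx, rfl⟩ := h.exists_eq_cls hs
    obtain ⟨y, hy, rfl⟩ := h.exists_eq_cls hs'
    obtain ⟨t, ht⟩ := skeleton_surjective (m := m) (tail c : Skeleton n)
    have ht' : skeleton t ∈ tailIdeal n c := ht ▸ tail_mem_tailIdeal c
    have step : ∀ {y} (hy : skeleton y ∈ tailIdeal n c),
        Relation.EqvGen (fun s a : TruncatedTL m n k l => ∃ b, ¬ IsUnit a ∧ ¬ IsUnit b ∧ s = b * a)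
          (h.cls (t * y) (by rw [map_mul]; exact mul_mem_tailIdeal _ ht')) (h.cls y hy) :=
      fun hy => Relation.EqvGen.rel _ _
        ⟨h.cls t ht', h.not_isUnit_cls _, h.not_isUnit_cls _, rfl⟩
    exact ((step hx).symm.trans _ _ _ (h.eqvGen_of_leftRel (leftRel_of_mem hc hx hy) ht rfl rfl
      _ _)).trans _ _ _ (step hy)

theorem eqvGen_of_rightRel [NeZero m] (h : IsTruncation m n k l c d) {a b : Skeleton n}
    (hab : RightRel n c a b) {t x y : cyclicTL m n} (ht : skeleton t = tail c)
    (hx : skeleton x = a) (hy : skeleton y = b) (htx : skeleton (x * t) ∈ tailIdeal n c)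
    (hty : skeleton (y * t) ∈ tailIdeal n c) :
    Relation.EqvGen (fun s a : TruncatedTL m n k l => ∃ b, ¬ IsUnit a ∧ ¬ IsUnit b ∧ s = a * b)
      (h.cls (x * t) htx) (h.cls (y * t) hty) := by
  have ht' : skeleton t ∈ tailIdeal n c := ht ▸ tail_mem_tailIdeal c
  have step : ∀ {z y : cyclicTL m n} (hz : skeleton z ∈ tailIdeal n c)
      (hy : skeleton y ∈ tailIdeal n c) (hzy : skeleton (y * z) ∈ tailIdeal n c),
      Relation.EqvGen (fun s a : TruncatedTL m n k l => ∃ b, ¬ IsUnit a ∧ ¬ IsUnit b ∧ s = a * b)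
        (h.cls (y * z) hzy) (h.cls y hy) := fun hz hy _ =>
    Relation.EqvGen.rel _ _ ⟨h.cls _ hz, h.not_isUnit_cls _, h.not_isUnit_cls _, rfl⟩
  induction hab generalizing x y with
  | rel s a hsa =>
    obtain ⟨b, hb, ha, rfl⟩ := hsa
    rw [← hy] at hx ha
    obtain ⟨z, hz, rfl⟩ := exists_eq_mul_left hx
    have hb' : skeleton (z * t) ∈ tailIdeal n c := by
      rw [map_mul, hz]; exact mul_mem_tailIdeal _ hb
    have h1 := step hb' ha (by rw [← mul_assoc]; exact htx)
    simp only [← mul_assoc] at h1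
    exact h1.trans _ _ _ (step ht' ha hty).symm
  | refl a =>
    obtain ⟨z, hz, e⟩ := exists_eq_mul_left (x := x * t) (y := y * t) (a := tail c) (by
      rw [map_mul, map_mul, ht, hx, hy, mul_assoc, tail_mul_self h.two_mul_c_le])
    have h1 := step (hz ▸ tail_mem_tailIdeal c) hty (e ▸ htx)
    simp only [← e] at h1
    exact h1
  | symm _ _ _ ih => exact (ih hy hx hty htx).symm
  | trans a b d _ _ ih1 ih2 =>
    obtain ⟨w, hw⟩ := skeleton_surjective (m := m) b
    have htw : skeleton (w * t) ∈ tailIdeal n c := by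
      rw [map_mul]; exact mul_mem_tailIdeal' _ ht'
    exact (ih1 hx hw htx htw).trans _ _ _ (ih2 hw hy htw hty)

theorem isRightConnected [NeZero m] (h : IsTruncation m n k l c d) :
    IsRightConnected (TruncatedTL m n k l) := by
  refine ⟨let ⟨s, _, hs, _⟩ := h.exists_ne; ⟨s, hs⟩, fun s s' hs hs' => ?_⟩
  rcases h.k_eq with hd | ⟨-, -, hc⟩
  · obtain ⟨z, hz, hz'⟩ := h.exists_zero hd
    exact (Relation.EqvGen.rel _ _ ⟨z, hs, hz, (hz' s).2.symm⟩).symm.trans _ _ _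
      (Relation.EqvGen.rel _ _ ⟨z, hs', hz, (hz' s').2.symm⟩)
  · obtain ⟨x, hx, rfl⟩ := h.exists_eq_cls hs
    obtain ⟨y, hy, rfl⟩ := h.exists_eq_cls hs'
    obtain ⟨t, ht⟩ := skeleton_surjective (m := m) (tail c : Skeleton n)
    have ht' : skeleton t ∈ tailIdeal n c := ht ▸ tail_mem_tailIdeal c
    have step : ∀ {y} (hy : skeleton y ∈ tailIdeal n c),
        Relation.EqvGen (fun s a : TruncatedTL m n k l => ∃ b, ¬ IsUnit a ∧ ¬ IsUnit b ∧ s = a * b)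
          (h.cls (y * t) (by rw [map_mul]; exact mul_mem_tailIdeal' _ ht')) (h.cls y hy) :=
      fun hy => Relation.EqvGen.rel _ _
        ⟨h.cls t ht', h.not_isUnit_cls _, h.not_isUnit_cls _, rfl⟩
    exact ((step hx).symm.trans _ _ _ (h.eqvGen_of_rightRel (rightRel_of_mem hc hx hy) ht rfl rfl
      _ _)).trans _ _ _ (step hy)

/-- A zero element `z` gives `f z = f z * f s`. Otherwise `f` takes elements over `tail d` to
`m`-torsion, which is trivial in characteristic not dividing `m`, and compression by `tail d`
reaches every element. -/
theorem hom_eq_one [NeZero m] {K : Type u} [Field K] (hchar : ¬ ringChar K ∣ m)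
    (h : IsTruncation m n k l c d) (f : TruncatedTL m n k l →* Multiplicative K) : f = 1 := by
  refine MonoidHom.ext fun s => ?_
  change f s = 1
  rcases h.k_eq with hd | ⟨-, hd, -⟩
  · obtain ⟨z, -, hz⟩ := h.exists_zero hd
    have := congrArg f (hz s).1
    rw [map_mul] at this
    exact mul_eq_left.1 this
  · have htorsion : ∀ g : Multiplicative K, g ^ m = 1 → g = 1 := by
      intro g hg
      have h1 : (m : K) * Multiplicative.toAdd g = 0 := by
        have := congrArg Multiplicative.toAdd hg
        rwa [toAdd_pow, toAdd_one, nsmul_eq_mul] at this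
      rcases mul_eq_zero.1 h1 with h2 | h2
      · exact absurd ((ringChar.spec K m).1 h2) hchar
      · exact toAdd_eq_zero.1 h2
    obtain ⟨x, rfl⟩ := proj_surjective s
    obtain ⟨t, ht⟩ := skeleton_surjective (m := m) (tail d : Skeleton n)
    have ht' : skeleton t ∈ tailIdeal n c := ht ▸ h.tail_mem
    have hidem : ∀ (w : cellSubmonoid (throughCell m n l)), skeleton w.1 = tail d →
        f (proj k w) = 1 := by
      intro w hw
      have h1 : w ^ (m + 1) = w := Subtype.ext
        (pow_add_one_of_idempotent (by rw [hw, tail_mul_self h.two_mul_d_le]))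
      have h2 : f (proj k (w ^ (m + 1))) = f (proj k w) := by rw [h1]
      rw [map_pow, map_pow, pow_succ] at h2
      exact htorsion _ (mul_eq_right.1 h2)
    let t' : cellSubmonoid (throughCell m n l) := ⟨t, Or.inl (h.mem_of_skeleton t ht')⟩
    have h1 := hidem t' ht
    -- As `n - 2 * d = k ≤ 1`, the product lies over `tail d` again, whatever `x` is.
    have h2 := hidem (t' * x * t') (by
      change skeleton (t * x.1 * t) = _
      rw [map_mul, map_mul, ht, tail_mul_mul_tail h.two_mul_d_le (by have := h.k_eq; omega)])
    rwa [map_mul, map_mul, map_mul, map_mul, h1, one_mul, mul_one] at h2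

end IsTruncation

end TruncatedTL

/-! ### Sums of trivial representations -/

section TrivialRepresentations

variable {K : Type u} [Field K] {S : Type*} [Monoid S] [Finite S]

theorem trivialChar_true (s : S) : trivialChar K S true s = 1 := by
  simp [trivialChar]

theorem trivialChar_of_isUnit (ε : Bool) {s : S} (hs : IsUnit s) : trivialChar K S ε s = 1 :=
  if_pos (Or.inr hs)

theorem trivialChar_false {s : S} (hs : ¬ IsUnit s) : trivialChar K S false s = 0 :=
  if_neg (by simp [hs])

theorem trivialSum_single {r : ℕ} (ε : Fin r → Bool) (s : S) (i : Fin r) :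
    trivialSum K S ε s (Pi.single i 1) = trivialChar K S (ε i) s • Pi.single i 1 := by
  ext j
  change trivialChar K S (ε j) s • (Pi.single i 1 : Fin r → K) j = _
  by_cases h : j = i
  · subst h; simp
  · simp [h]

theorem isUnit_of_isUnit_mul {s t : S} (h : IsUnit (s * t)) : IsUnit s ∧ IsUnit t := by
  -- The character of 𝟙_b is multiplicative and detects units; any field would serve in place of
  -- `ℚ`.
  have h1 : trivialChar ℚ S false (s * t) = 1 := trivialChar_of_isUnit false h
  rw [map_mul] at h1
  constructor
  · by_contra hs
    simp [trivialChar_false hs] at h1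
  · by_contra ht
    simp [trivialChar_false ht] at h1

variable {V : Type u} [AddCommGroup V] [Module K V]

/-- A simple representation contained in a sum of trivial ones is one-dimensional. -/
theorem Representation.IsIrreducible.isTrivialRep {ρ : Representation K S V}
    (hρ : ρ.IsIrreducible) (h : IsTrivialSum ρ) : IsTrivialRep ρ := by
  obtain ⟨r, ε, ⟨e⟩⟩ := h
  have hnt : Nontrivial V := by
    by_contra hV
    rw [not_nontrivial_iff_subsingleton] at hV
    have : Subsingleton (Subrepresentation ρ) :=
      ⟨fun a b => Subrepresentation.toSubmodule_injective (Subsingleton.elim _ _)⟩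
    exact not_subsingleton (Subrepresentation ρ) this
  have hr : 0 < r := by
    rcases Nat.eq_zero_or_pos r with rfl | h
    · obtain ⟨v, hv⟩ := exists_ne (0 : V)
      exact absurd (e.toLinearEquiv.injective (Subsingleton.elim _ _)) hv
    · exact h
  -- A coordinate vector spans an invariant line, which by simplicity is the whole space.
  let w : V := e.toLinearEquiv.symm (Pi.single ⟨0, hr⟩ 1)
  have hw : w ≠ 0 := by
    intro h0
    have := congrArg e.toLinearEquiv h0
    simp only [w, LinearEquiv.apply_symm_apply, map_zero] at this
    exact one_ne_zero (α := K) (by simpa using congrFun this ⟨0, hr⟩)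
  have hρw : ∀ s, ρ s w = trivialChar K S (ε ⟨0, hr⟩) s • w := by
    intro s
    apply e.toLinearEquiv.injective
    have := LinearMap.congr_fun (e.isIntertwining' s) w
    rw [map_smul]
    refine Eq.trans this ?_
    change trivialSum K S ε s (e.toLinearEquiv w) = _
    simp only [w, LinearEquiv.apply_symm_apply]
    exact trivialSum_single ε s _
  let W : Subrepresentation ρ := ⟨Submodule.span K {w}, fun s v hv => by
    obtain ⟨a, rfl⟩ := Submodule.mem_span_singleton.1 hv
    rw [map_smul, hρw]
    exact Submodule.smul_mem _ _ (Submodule.smul_mem _ _ (Submodule.mem_span_singleton_self w))⟩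
  have hW : W = ⊤ := by
    rcases hρ.eq_bot_or_eq_top W with h | h
    · have h1 : W.toSubmodule = ⊥ := congrArg Subrepresentation.toSubmodule h
      exact absurd (Submodule.span_singleton_eq_bot.1 h1) hw
    · exact h
  have h1 : Submodule.span K {w} = ⊤ := congrArg Subrepresentation.toSubmodule hW
  have h2 : Module.finrank K V = 1 := by
    rw [← finrank_top K V, ← h1, finrank_span_singleton hw]
  have h3 : Module.finrank K V = r := by
    rw [e.toLinearEquiv.finrank_eq, Module.finrank_fin_fun]
  obtain rfl : r = 1 := h3.symm.trans h2
  exact ⟨ε, ⟨e⟩⟩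

theorem IsTrivialRep.exists_eigenvector {ρ : Representation K S V} (h : IsTrivialRep ρ) :
    ∃ (ε : Bool) (w : V), w ≠ 0 ∧ ∀ s, ρ s w = trivialChar K S ε s • w := by
  obtain ⟨ε, ⟨e⟩⟩ := h
  refine ⟨ε 0, e.toLinearEquiv.symm (Pi.single 0 1), ?_, fun s => ?_⟩
  · intro h0
    have := congrArg e.toLinearEquiv h0
    simp only [LinearEquiv.apply_symm_apply, map_zero] at this
    exact one_ne_zero (α := K) (by simpa using congrFun this 0)
  · apply e.toLinearEquiv.injective
    have := LinearMap.congr_fun (e.isIntertwining' s) (e.toLinearEquiv.symm (Pi.single 0 1))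
    rw [map_smul]
    refine Eq.trans this ?_
    change trivialSum K S ε s (e.toLinearEquiv _) = _
    simp only [LinearEquiv.apply_symm_apply]
    exact trivialSum_single ε s _

/-- The range of `e` is a sum of copies of 𝟙_t, its kernel a sum of copies of 𝟙_b, and the two are
complementary. -/
theorem isTrivialSum_of_idempotent [Module.Finite K V] {ρ : Representation K S V} {e : V →ₗ[K] V}
    (he : e * e = e) (hunit : ∀ s, IsUnit s → ρ s = 1) (hnon : ∀ s, ¬ IsUnit s → ρ s = e) :
    IsTrivialSum ρ := by
  have hc := LinearMap.IsIdempotentElem.isCompl (f := e) he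
  let b := ((Module.finBasis K (LinearMap.range e)).prod (Module.finBasis K (LinearMap.ker e))).map
    (Submodule.prodEquivOfIsCompl _ _ hc)
  let b' := b.reindex finSumFinEquiv
  let ε : Fin (Module.finrank K (LinearMap.range e) + Module.finrank K (LinearMap.ker e)) → Bool :=
    fun i => (finSumFinEquiv.symm i).isLeft
  have hb : ∀ i s, ρ s (b' i) = trivialChar K S (ε i) s • b' i := by
    intro i s
    obtain ⟨j, rfl⟩ := finSumFinEquiv.surjective i
    by_cases hs : IsUnit s
    · rw [hunit s hs, trivialChar_of_isUnit _ hs, one_smul]; rfl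
    · rw [hnon s hs]
      rcases j with j | j
      · have h1 : b' (finSumFinEquiv (Sum.inl j)) =
            (Module.finBasis K (LinearMap.range e) j : V) := by
          simp [b', b]
        have h2 : ε (finSumFinEquiv (Sum.inl j)) = true := by simp [ε]
        rw [h1, h2, trivialChar_true, one_smul]
        obtain ⟨v, hv⟩ := (Module.finBasis K (LinearMap.range e) j).2
        rw [← hv, ← Module.End.mul_apply, he]
      · have h1 : b' (finSumFinEquiv (Sum.inr j)) =
            (Module.finBasis K (LinearMap.ker e) j : V) := by
          simp [b', b]
        have h2 : ε (finSumFinEquiv (Sum.inr j)) = false := by simp [ε]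
        rw [h1, h2, trivialChar_false hs, zero_smul]
        exact (Module.finBasis K (LinearMap.ker e) j).2
  refine ⟨_, ε, ⟨Representation.Equiv.mk b'.equivFun fun s => b'.ext fun i => ?_⟩⟩
  rw [LinearMap.comp_apply, LinearMap.comp_apply, hb]
  simp only [map_smul, LinearEquiv.coe_coe]
  have : b'.equivFun (b' i) = Pi.single i 1 := by
    ext j
    simp [Pi.single_apply, eq_comm]
  rw [this, trivialSum_single]

end TrivialRepresentations

/-- A nonzero subrepresentation of least dimension is simple. -/
theorem exists_irreducible_subrepresentation {K : Type u} [Field K] {S : Type*} [Monoid S]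
    {V : Type u} [AddCommGroup V] [Module K V] [Module.Finite K V] [Nontrivial V]
    (ρ : Representation K S V) : ∃ W : Subrepresentation ρ, W.toRepresentation.IsIrreducible := by
  have hex : ∃ d, ∃ W : Subrepresentation ρ, W.toSubmodule ≠ ⊥ ∧
      Module.finrank K W.toSubmodule = d :=
    ⟨_, ⊤, top_ne_bot (α := Submodule K V), rfl⟩
  classical
  obtain ⟨W, hW, hd⟩ := Nat.find_spec hex
  refine ⟨W, ?_⟩
  have hbt : (⊥ : Subrepresentation W.toRepresentation) ≠ ⊤ := by
    intro h
    have h1 : (⊥ : Submodule K W.toSubmodule) = ⊤ := congrArg Subrepresentation.toSubmodule h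
    obtain ⟨v, hv, hv0⟩ := Submodule.exists_mem_ne_zero_of_ne_bot hW
    have h2 : (⟨v, hv⟩ : W.toSubmodule) ∈ (⊥ : Submodule K W.toSubmodule) := h1 ▸ Submodule.mem_top
    exact hv0 (congrArg Subtype.val ((Submodule.mem_bot K).1 h2))
  have : Nontrivial (Subrepresentation W.toRepresentation) := ⟨⊥, ⊤, hbt⟩
  refine ⟨fun U => ?_⟩
  by_cases hU : U.toSubmodule = ⊥
  · exact Or.inl (Subrepresentation.toSubmodule_injective hU)
  · right
    let U' : Subrepresentation ρ := ⟨U.toSubmodule.map W.toSubmodule.subtype, by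
      rintro s _ ⟨v, hv, rfl⟩
      exact ⟨_, U.apply_mem_toSubmodule s hv, rfl⟩⟩
    have hfin : Module.finrank K U'.toSubmodule = Module.finrank K U.toSubmodule :=
      Submodule.finrank_map_subtype_eq _ _
    have hle : Module.finrank K W.toSubmodule ≤ Module.finrank K U.toSubmodule := by
      rw [hd, ← hfin]
      refine Nat.find_min' hex ⟨U', fun h => hU ?_, rfl⟩
      exact Submodule.map_injective_of_injective W.toSubmodule.injective_subtype
        (Eq.trans h (Submodule.map_bot _).symm)
    exact Subrepresentation.toSubmodule_injective
      (Submodule.eq_top_of_finrank_eq (le_antisymm (Submodule.finrank_le _) hle))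

/-! ### Extensions of trivial representations -/

section Extensions

variable {K : Type u} [Field K] {S : Type*} [Monoid S] [Finite S] {m : ℕ}

/-- In an extension of a sum of trivial representations by a trivial one the invertible elements
act trivially. -/
theorem eq_one_of_isUnit_of_extension {V : Type u} [AddCommGroup V] [Module K V]
    (hm : (m : K) ≠ 0) (hpow : ∀ s : S, IsUnit s → s ^ m = 1) {ρ : Representation K S V} {w : V}
    {ε : Bool} (hw : ∀ s, ρ s w = trivialChar K S ε s • w)
    (hunit : ∀ s, IsUnit s → ∀ v, ρ s v - v ∈ Submodule.span K {w}) {s : S} (hs : IsUnit s) :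
    ρ s = 1 := by
  ext v
  have hfix : ρ s (ρ s v - v) = ρ s v - v := by
    obtain ⟨a, ha⟩ := Submodule.mem_span_singleton.1 (hunit s hs v)
    rw [← ha, map_smul, hw, trivialChar_of_isUnit ε hs, one_smul]
  -- The operator is unipotent with `(ρ s - 1) ^ 2 = 0`, so its powers grow linearly; at `t = m`
  -- this forces `m • (ρ s v - v) = 0`.
  have hiter : ∀ t : ℕ, ρ (s ^ t) v = v + (t : K) • (ρ s v - v) := by
    intro t
    induction t with
    | zero => simp
    | succ t ih =>
      rw [pow_succ', map_mul, Module.End.mul_apply, ih, map_add, map_smul, hfix]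
      push_cast
      module
  have h1 := hiter m
  rw [hpow s hs, map_one, Module.End.one_apply, left_eq_add, smul_eq_zero] at h1
  exact sub_eq_zero.1 (h1.resolve_left hm)

/-- Differences of non-units have values in the line of `w`. If `w` spans 𝟙_b, a non-unit on the
left kills them; if it spans 𝟙_t, every element fixes them, and the obstruction becomes an additive
character. -/
theorem eq_of_not_isUnit_of_extension {V : Type u} [AddCommGroup V] [Module K V]
    (hnull : IsNullConnected S) (hleft : IsLeftConnected S) (hright : IsRightConnected S)
    (hhom : ∀ f : S →* Multiplicative K, f = 1)
    {ρ : Representation K S V} {w : V} {ε : Bool} (hw : ∀ s, ρ s w = trivialChar K S ε s • w)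
    (hnon : ∀ s t, ¬ IsUnit s → ¬ IsUnit t → ∀ v, ρ s v - ρ t v ∈ Submodule.span K {w})
    {s t : S} (hs : ¬ IsUnit s) (ht : ¬ IsUnit t) : ρ s = ρ t := by
  have hmulr : ∀ {a : S} (b : S), ¬ IsUnit a → ¬ IsUnit (a * b) := fun b ha h =>
    ha (isUnit_of_isUnit_mul h).1
  have hmull : ∀ {a : S} (b : S), ¬ IsUnit a → ¬ IsUnit (b * a) := fun b ha h =>
    ha (isUnit_of_isUnit_mul h).2
  cases ε with
  | false =>
    have h1 : ∀ a b c, ¬ IsUnit a → ¬ IsUnit b → ¬ IsUnit c → ρ (a * b) = ρ (a * c) := by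
      intro a b c ha hb hc
      ext v
      obtain ⟨x, hx⟩ := Submodule.mem_span_singleton.1 (hnon b c hb hc v)
      rw [map_mul, map_mul, Module.End.mul_apply, Module.End.mul_apply, ← sub_eq_zero, ← map_sub,
        ← hx, map_smul, hw, trivialChar_false ha, zero_smul, smul_zero]
    have h2 : ∀ a b, ¬ IsUnit a → ¬ IsUnit b → ρ (a * b) = ρ a := by
      intro a b ha hb
      -- Both `a * b = c * (d * b)` and `a = c * d` are now `c` times a non-unit.
      obtain ⟨c, d, hc, hd, rfl⟩ := hnull a ha
      rw [mul_assoc]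
      exact h1 c _ d hc (hmulr b hd) hd
    have h3 := hright.2 s t hs ht
    have h4 : ∀ x y, Relation.EqvGen (fun s a : S => ∃ b, ¬ IsUnit a ∧ ¬ IsUnit b ∧ s = a * b) x y →
        ρ x = ρ y := by
      intro x y h
      induction h with
      | rel x y h =>
        obtain ⟨b, hy, hb, rfl⟩ := h
        exact h2 y b hy hb
      | refl => rfl
      | symm _ _ _ ih => exact ih.symm
      | trans _ _ _ _ _ ih1 ih2 => exact ih1.trans ih2
    exact h4 s t h3
  | true =>
    have hfix : ∀ a b c, ¬ IsUnit b → ¬ IsUnit c → ∀ v, ρ a (ρ b v - ρ c v) = ρ b v - ρ c v := by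
      intro a b c hb hc v
      obtain ⟨x, hx⟩ := Submodule.mem_span_singleton.1 (hnon b c hb hc v)
      rw [← hx, map_smul, hw, trivialChar_true, one_smul]
    have hsub : ∀ a b c, ¬ IsUnit b → ¬ IsUnit c →
        ρ (a * b) - ρ (a * c) = ρ b - ρ c := by
      intro a b c hb hc
      ext v
      rw [map_mul, map_mul, LinearMap.sub_apply, Module.End.mul_apply, Module.End.mul_apply,
        ← map_sub, hfix a b c hb hc, LinearMap.sub_apply]
    have hdiff : ∀ a b c, ¬ IsUnit b → ¬ IsUnit c → ρ (a * b) - ρ b = ρ (a * c) - ρ c := by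
      intro a b c hb hc
      have := hsub a b c hb hc
      rw [sub_eq_sub_iff_add_eq_add] at this ⊢
      rw [this, add_comm]
    obtain ⟨c, hc⟩ := hleft.1
    -- The difference `ρ (a * x) - ρ x` is the same for all non-units `x`, in particular for `b * c`
    -- and `c`.
    have hadd : ∀ a b, ρ (a * b * c) - ρ c = (ρ (a * c) - ρ c) + (ρ (b * c) - ρ c) := by
      intro a b
      have := hdiff a (b * c) c (hmull b hc) hc
      rw [← this, mul_assoc]
      abel
    have hfun : ∀ (φ : Module.Dual K V) (v : V) (a : S), φ ((ρ (a * c) - ρ c) v) = 0 := by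
      intro φ v a
      let f : S →* Multiplicative K :=
        { toFun := fun a => Multiplicative.ofAdd (φ ((ρ (a * c) - ρ c) v))
          map_one' := by simp
          map_mul' := fun a b => by
            rw [hadd, LinearMap.add_apply, map_add, ofAdd_add] }
      have := DFunLike.congr_fun (hhom f) a
      exact ofAdd_eq_one.1 this
    have h2 : ∀ a b, ¬ IsUnit b → ρ (a * b) = ρ b := by
      intro a b hb
      rw [← sub_eq_zero, hdiff a b c hb hc]
      ext v
      rw [LinearMap.zero_apply]
      exact (Module.forall_dual_apply_eq_zero_iff K _).1 fun φ => hfun φ v a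
    have h4 : ∀ x y, Relation.EqvGen (fun s a : S => ∃ b, ¬ IsUnit a ∧ ¬ IsUnit b ∧ s = b * a) x y →
        ρ x = ρ y := by
      intro x y h
      induction h with
      | rel x y h =>
        obtain ⟨b, hy, hb, rfl⟩ := h
        exact h2 b y hy
      | refl => rfl
      | symm _ _ _ ih => exact ih.symm
      | trans _ _ _ _ _ ih1 ih2 => exact ih1.trans ih2
    exact h4 s t (hleft.2 s t hs ht)

/-- If all simple representations of dimension at most `r` are trivial, then in a representation of
dimension at most `r` all invertible elements act by the identity and all other elements act by the
same operator. -/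
theorem eq_one_and_eq_of_simple_trivial (hm : (m : K) ≠ 0) (hpow : ∀ s : S, IsUnit s → s ^ m = 1)
    (hnull : IsNullConnected S) (hleft : IsLeftConnected S) (hright : IsRightConnected S)
    (hhom : ∀ f : S →* Multiplicative K, f = 1) {r : ℕ}
    (hsimple : ∀ (V : Type u) [AddCommGroup V] [Module K V] [Module.Finite K V]
      (ρ : Representation K S V), Module.finrank K V ≤ r → ρ.IsIrreducible → IsTrivialRep ρ)
    (V : Type u) [AddCommGroup V] [Module K V] [Module.Finite K V] (ρ : Representation K S V)
    (hr : Module.finrank K V ≤ r) :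
    (∀ s, IsUnit s → ρ s = 1) ∧ ∀ s t, ¬ IsUnit s → ¬ IsUnit t → ρ s = ρ t := by
  induction hd : Module.finrank K V using Nat.strong_induction_on generalizing V with
  | _ d ih =>
    rcases subsingleton_or_nontrivial V with hV | hV
    · exact ⟨fun _ _ => Subsingleton.elim _ _, fun _ _ _ _ => Subsingleton.elim _ _⟩
    -- The simple subrepresentation is trivial by hypothesis and provides the eigenvector; the
    -- quotient by its span has smaller dimension.
    obtain ⟨W, hW⟩ := exists_irreducible_subrepresentation ρ
    obtain ⟨ε, w', hw0', hw'⟩ := (hsimple W.toSubmodule W.toRepresentation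
      ((Submodule.finrank_le _).trans hr) hW).exists_eigenvector
    let w : V := w'
    have hw0 : w ≠ 0 := fun h => hw0' (Subtype.ext h)
    have hw : ∀ s, ρ s w = trivialChar K S ε s • w := fun s => congrArg Subtype.val (hw' s)
    have hle : ∀ s, Submodule.span K {w} ≤ (Submodule.span K {w}).comap (ρ s) := by
      intro s
      rw [Submodule.span_singleton_le_iff_mem, Submodule.mem_comap, hw]
      exact Submodule.smul_mem _ _ (Submodule.mem_span_singleton_self w)
    have hfin := Submodule.finrank_quotient_add_finrank (Submodule.span K {w})
    rw [finrank_span_singleton hw0] at hfin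
    obtain ⟨h1, h2⟩ := ih _ (by omega) (V ⧸ Submodule.span K {w})
      (ρ.quotient (Submodule.span K {w}) hle) (by omega) rfl
    have hq : ∀ s v, ρ.quotient (Submodule.span K {w}) hle s (Submodule.Quotient.mk v) =
      Submodule.Quotient.mk (ρ s v) := fun _ _ => rfl
    have hunit : ∀ s, IsUnit s → ρ s = 1 := fun s hs =>
      eq_one_of_isUnit_of_extension hm hpow hw (fun s hs v => by
        rw [← Submodule.Quotient.eq, ← hq, h1 s hs, Module.End.one_apply]) hs
    refine ⟨hunit, fun s t hs ht => eq_of_not_isUnit_of_extension hnull hleft hright hhom hw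
      (fun s t hs ht v => ?_) hs ht⟩
    rw [← Submodule.Quotient.eq, ← hq, ← hq, h2 s t hs ht]

end Extensions

/-- The regular representation on functions. -/
def functionRepresentation (K : Type u) [Field K] (S : Type) [Monoid S] :
    Representation K S (S → K) where
  toFun s := LinearMap.funLeft K K fun x => x * s
  map_one' := by
    ext
    simp [LinearMap.funLeft_apply]
  map_mul' s t := by
    ext
    simp [LinearMap.funLeft_apply, mul_assoc]

/-! ### The representation gap -/

section Gap

variable {K : Type u} [Field K] {S : Type} [Monoid S] [Finite S] {m : ℕ}

/-- Below the least dimension of a nontrivial simple representation, the non-units act by a common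
idempotent and every representation splits. At that dimension, the simple representation itself is
not a sum of trivial ones. -/
theorem exists_isRepresentationGap (hm : (m : K) ≠ 0) (hpow : ∀ s : S, IsUnit s → s ^ m = 1)
    (hnull : IsNullConnected S) (hleft : IsLeftConnected S) (hright : IsRightConnected S)
    (hhom : ∀ f : S →* Multiplicative K, f = 1)
    (hne : ∃ s t : S, ¬ IsUnit s ∧ ¬ IsUnit t ∧ s ≠ t) :
    ∃ g : ℕ, IsRepresentationGap K S g ∧ IsLeast (nontrivialSimpleDims K S) g := by
  classical
  have hlow : ∀ r : ℕ, (∀ d ∈ nontrivialSimpleDims K S, r < d) →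
      ∀ (V : Type u) [AddCommGroup V] [Module K V] [Module.Finite K V]
        (ρ : Representation K S V), Module.finrank K V ≤ r →
        (∀ s, IsUnit s → ρ s = 1) ∧ ∀ s t, ¬ IsUnit s → ¬ IsUnit t → ρ s = ρ t := by
    intro r hr
    refine eq_one_and_eq_of_simple_trivial hm hpow hnull hleft hright hhom ?_
    intro V _ _ _ ρ hV hρ
    by_contra hnot
    exact absurd (hr _ ⟨V, _, _, inferInstance, ρ, hρ, hnot, rfl⟩) (not_lt.2 hV)
  obtain ⟨s, t, hs, ht, hst⟩ := hne
  have hnonempty : ∃ d, d ∈ nontrivialSimpleDims K S := by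
    by_contra hempty
    push Not at hempty
    obtain ⟨-, h⟩ := hlow (Module.finrank K (S → K)) (fun d hd => absurd hd (hempty d)) (S → K)
      (functionRepresentation K S) le_rfl
    -- If no nontrivial simple existed, `s` and `t` would act equally on functions; the indicator of
    -- `s`, evaluated at `1` after translation, separates them.
    have h1 := congrFun (LinearMap.congr_fun (h s t hs ht) (Pi.single s 1)) 1
    change (Pi.single s 1 : S → K) (1 * s) = (Pi.single s 1 : S → K) (1 * t) at h1
    simp [hst.symm] at h1
  have hleast : IsLeast (nontrivialSimpleDims K S) (Nat.find hnonempty) :=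
    ⟨Nat.find_spec hnonempty, fun d hd => Nat.find_min' hnonempty hd⟩
  refine ⟨Nat.find hnonempty, ⟨⟨fun _ => ⟨⟨fun e => hst ?_⟩, ⟨fun e => hst ?_⟩⟩, ?_⟩, ?_⟩, hleast⟩
  · exact e.injective (Subsingleton.elim _ _)
  -- An isomorphism with the two-element monoid would send both `s` and `t` to zero.
  · have hzero : ∀ a, ¬ IsUnit a → e a = 0 := by
      intro a ha
      by_contra h
      have h1 : IsUnit (e a) := IsUnit.mk0 _ h
      have h2 := h1.map e.symm
      rw [MulEquiv.symm_apply_apply] at h2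
      exact ha h2
    exact e.injective ((hzero s hs).trans (hzero t ht).symm)
  · intro V _ _ _ ρ hV
    obtain ⟨h1, h2⟩ := hlow (Module.finrank K V)
      (fun d hd => by have := hleast.2 hd; omega) V ρ le_rfl
    refine isTrivialSum_of_idempotent (e := ρ s) ?_ h1 fun a ha => h2 a s ha hs
    rw [← map_mul]
    exact h2 _ _ (fun h => hs (isUnit_of_isUnit_mul h).1) hs
  · intro r hr
    by_contra hlt
    obtain ⟨V, _, _, _, ρ, hρ, hnot, hd⟩ := hleast.1
    exact hnot (hρ.isTrivialRep (hr.2 V ρ (by omega)))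

end Gap

/-- The condition `hedge` excludes exactly `(3, 1, 3)` and `(4, 0, 4)`: for `l = n < 5` and `k ≤ 1`,
parity and `3 ≤ l` leave only these triples. -/
theorem propositionP {K : Type u} [Field K] (m n k l : ℕ) [NeZero m]
    (hk : k ≡ n [MOD 2]) (hl : l ≡ n [MOD 2]) (hkl : k < l) (hln : l ≤ n) (hl3 : 3 ≤ l)
    (hedge : l = n → 2 ≤ k ∨ 5 ≤ n) (hchar : ¬ ringChar K ∣ m) :
    (IsNullConnected (TruncatedTL m n k l) ∧ IsLeftConnected (TruncatedTL m n k l) ∧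
      IsRightConnected (TruncatedTL m n k l)) ∧
    (∀ f : TruncatedTL m n k l →* Multiplicative K, f = 1) ∧
    ∃ g : ℕ, IsRepresentationGap K (TruncatedTL m n k l) g ∧
      IsLeast (nontrivialSimpleDims K (TruncatedTL m n k l)) g := by
  obtain ⟨c, d, h⟩ := TruncatedTL.exists_isTruncation (m := m) hk hl hkl hln hl3 hedge
  exact ⟨⟨h.isNullConnected, h.isLeftConnected, h.isRightConnected⟩, h.hom_eq_one hchar,
    exists_isRepresentationGap (fun hm => hchar ((ringChar.spec K m).1 hm))
      (fun _ => h.pow_eq_one_of_isUnit) h.isNullConnected h.isLeftConnected h.isRightConnected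
      (h.hom_eq_one hchar) h.exists_ne⟩
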